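/- Let $n\ge 1$, $p\ge 0$ and let $f_1,\dots,f_n:\mathbb R^p\to\mathbb R$ be continuously differentiable with $\|\nabla f_i(x)-\nabla f_i(u)\|\le L\|x-u\|$ for all $x,u$, where $L>0$. Let $f=\frac1n\sum_i f_i$ satisfy $\langle\nabla f(x)-\nabla f(u),x-u\rangle\ge\mu\|x-u\|^2$ for all $x,u$, where $\mu>0$, and let $x^*$ be the minimizer of $f$ over $\mathbb R^p$. For $k\ge0$ let $\mathbb G_k=([n],\mathcal E_k)$ be a strongly connected directed graph, $A_k$ a row-stochastic and $B_k$ a column-stochastic $n\times n$ matrix such that $[A_k]_{ij}$ and $[B_k]_{ij}$ are positive if $(j,i)\in\mathcal E_k$ or $i=j$, and are zero otherwise. Let $a,b>0$ be such that all positive entries of every $A_k$ are at least $a$ and all positive entries of every $B_k$ are at least $b$. Let $\{\phi_k\}_{k\ge0}$ be stochastic vectors with $\phi_{k+1}^{\mathsf T}A_k=\phi_k^{\mathsf T}$ for all $k\ge0$, and let $\pi_0=\frac1n\mathbf 1$, $\pi_{k+1}=B_k\pi_k$. Let $0<\alpha<\frac{2}{nL}$ and $\beta,\gamma\ge0$.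 Given arbitrary $x_{-1}^i,x_0^i,s_0^i\in\mathbb R^p$ and $y_0^i=\nabla f_i(s_0^i)$, $i\in[n]$, let for all $k\ge0$ $$x_{k+1}^i=\sum_{j}[A_k]_{ij}s_k^j-\alpha y_k^i+\beta(x_k^i-x_{k-1}^i),\quad s_{k+1}^i=x_{k+1}^i+\gamma(x_{k+1}^i-x_k^i),\quad y_{k+1}^i=\sum_j[B_k]_{ij}y_k^j+\nabla f_i(s_{k+1}^i)-\nabla f_i(s_k^i).$$ Put $\hat x_k=\sum_i[\phi_k]_ix_k^i$, $\mathbf x_k=(x_k^1,\dots,x_k^n)$ with $\|\mathbf x_k\|^2=\sum_i\|x_k^i\|^2$, $$D_k=\sqrt{\sum_i[\phi_k]_i\|x_k^i-\hat x_k\|^2},\quad S_k=\sqrt{\sum_j[\pi_k]_j\Big\|\frac{y_k^j}{[\pi_k]_j}-\sum_\ell y_k^\ell\Big\|^2},\quad V_k=\big(\|\hat x_k-x^*\|,\,D_k,\,S_k,\,\|\mathbf x_k-\mathbf x_{k-1}\|\big)^{\mathsf T}.$$ Let $\mathsf D(\mathbb G)$ be the diameter of $\mathbb G$, i.e. the largest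 length of a shortest directed path between two distinct nodes. Let $\mathsf K(\mathbb G)$ be the maximum, over all choices of one shortest directed path for each ordered pair of distinct nodes and over all edges of $\mathbb G$, of the number of chosen paths that pass through the edge. With $\min(v),\max(v)$ the smallest and largest entries of $v$, put $$\varphi_k=\sqrt{\tfrac1{\min(\phi_k)}},\qquad r_k=\sqrt n+\tfrac1{\sqrt{\min(\pi_{k+1})}},\qquad c_k=\sqrt{1-\tfrac{\min(\phi_{k+1})\,a^2}{\max^2(\phi_k)\,\mathsf D(\mathbb G_k)\mathsf K(\mathbb G_k)}},$$ $$\tau_k=\sqrt{1-\tfrac{\min^2(\pi_k)\,b^2}{\max^2(\pi_k)\max(\pi_{k+1})\,\mathsf D(\mathbb G_k)\mathsf K(\mathbb G_k)}},\qquad q_k(\alpha)=\max\{|1-\alpha n\min(\pi_k)\mu|,\,|1-\alpha n\min(\pi_k)L|\}$$ (for $n=1$, where there are no pairs of distinct nodes, $c_k=\tau_k=1$). Let $M_k=M_k(\alpha,\beta,\gamma)=(m_k^{i,j})$ be the $4\times4$ matrix with \begin{align*} &m_k^{1,1}=q_k(\alpha),\quad m_k^{1,2}=\alpha L\sqrt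 n\,\varphi_k,\quad m_k^{1,3}=\alpha,\quad m_k^{1,4}=\beta+\gamma(1+\alpha L\sqrt n),\\ &m_k^{2,1}=\alpha L\sqrt n\,\varphi_k,\quad m_k^{2,2}=c_k+\alpha L\sqrt n\,\varphi_k,\quad m_k^{2,3}=\alpha,\quad m_k^{2,4}=\beta+\gamma(c_k+\alpha L\sqrt n),\\ &m_k^{3,1}=Lr_k(1+\gamma)m_k^{4,1},\quad m_k^{3,2}=Lr_k(1+\gamma)m_k^{4,2},\\ &m_k^{3,3}=\tau_k+Lr_k(1+\gamma)m_k^{4,3},\quad m_k^{3,4}=Lr_k\gamma+Lr_k(1+\gamma)m_k^{4,4},\\ &m_k^{4,1}=\alpha L\sqrt n\,\varphi_k,\quad m_k^{4,2}=c_k\varphi_{k+1}+\varphi_k+\alpha L\sqrt n\,\varphi_k,\quad m_k^{4,3}=\alpha,\quad m_k^{4,4}=\beta+\gamma\sqrt n(1+\alpha L). \end{align*} Then $V_{k+1}\le M_k(\alpha,\beta,\gamma)V_k$ entrywise for all $k\ge1$; if moreover $s_0^i=x_0^i+\gamma(x_0^i-x_{-1}^i)$ for all $i\in[n]$, the inequality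 also holds for $k=0$. -/

import Mathlib

open scoped Matrix

namespace ABPushPull

/-! ### Directed graphs: paths, diameter, maximal edge-utility -/

/-- `p` is the list of the (distinct) nodes visited by a directed path from `j` to `l`. -/
def IsDirPath {n : ℕ} (G : Digraph (Fin n)) (j l : Fin n) (p : List (Fin n)) : Prop :=
  p.head? = some j ∧ p.getLast? = some l ∧ p.IsChain G.Adj ∧ p.Nodup

/-- The number of edges of a path given by its list of nodes. -/
def pathLength {n : ℕ} (p : List (Fin n)) : ℕ := p.length - 1

/-- There is a directed path from any node to all other nodes. -/
def StronglyConnected {n : ℕ} (G : Digraph (Fin n)) : Prop :=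
  ∀ j l : Fin n, j ≠ l → ∃ p, IsDirPath G j l p

/-- `p` is a shortest directed path from `j` to `l`. -/
def IsShortestPath {n : ℕ} (G : Digraph (Fin n)) (j l : Fin n) (p : List (Fin n)) : Prop :=
  IsDirPath G j l p ∧ ∀ q, IsDirPath G j l q → pathLength p ≤ pathLength q

/-- The length of the longest among all shortest directed paths between ordered pairs of
distinct nodes. -/
noncomputable def diameter {n : ℕ} (G : Digraph (Fin n)) : ℕ :=
  sSup {m | ∃ j l p, j ≠ l ∧ IsShortestPath G j l p ∧ m = pathLength p}

/-- A shortest-path covering: a choice of one shortest directed path `P j l` for every ordered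
pair of distinct nodes (the values `P j j` play no role). -/
def IsCovering {n : ℕ} (G : Digraph (Fin n)) (P : Fin n → Fin n → List (Fin n)) : Prop :=
  ∀ j l : Fin n, j ≠ l → IsShortestPath G j l (P j l)

/-- The number of paths of the covering `P` that pass through the edge `(u, v)`. -/
noncomputable def edgeUtility {n : ℕ} (P : Fin n → Fin n → List (Fin n)) (u v : Fin n) : ℕ :=
  Set.ncard {e : Fin n × Fin n | e.1 ≠ e.2 ∧ [u, v] <:+: P e.1 e.2}

/-- The maximum edge-utility of a covering, over all edges of the graph. -/
noncomputable def coveringUtility {n : ℕ} (G : Digraph (Fin n))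
    (P : Fin n → Fin n → List (Fin n)) : ℕ :=
  sSup {m | ∃ u v, G.Adj u v ∧ m = edgeUtility P u v}

/-- The maximal edge-utility of the graph, over all shortest-path coverings. -/
noncomputable def maxEdgeUtility {n : ℕ} (G : Digraph (Fin n)) : ℕ :=
  sSup {m | ∃ P, IsCovering G P ∧ m = coveringUtility G P}

/-! ### Weight matrices aligned with a graph -/

/-- `[A]_{ij}` is positive if `j` is an in-neighbor of `i` or `j = i`, and zero otherwise. -/
def AlignedA {n : ℕ} (G : Digraph (Fin n)) (A : Matrix (Fin n) (Fin n) ℝ) : Prop :=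
  ∀ i j : Fin n,
    ((G.Adj j i ∨ j = i) → 0 < A i j) ∧ (¬ (G.Adj j i ∨ j = i) → A i j = 0)

/-- `[B]_{ji}` is positive if `j` is an out-neighbor of `i` or `j = i`, and zero otherwise. -/
def AlignedB {n : ℕ} (G : Digraph (Fin n)) (B : Matrix (Fin n) (Fin n) ℝ) : Prop :=
  ∀ i j : Fin n,
    ((G.Adj i j ∨ j = i) → 0 < B j i) ∧ (¬ (G.Adj i j ∨ j = i) → B j i = 0)

/-- The communication network: strongly connected digraphs `G k`, row-stochastic matrices `A k`
and column-stochastic matrices `B k` aligned with `G k`, with positive entries bounded below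
by `a > 0` and `b > 0` respectively. -/
structure IsNetwork {n : ℕ} (G : ℕ → Digraph (Fin n)) (A B : ℕ → Matrix (Fin n) (Fin n) ℝ)
    (a b : ℝ) : Prop where
  strong : ∀ k, StronglyConnected (G k)
  row : ∀ k, A k ∈ Matrix.rowStochastic ℝ (Fin n)
  col : ∀ k, B k ∈ Matrix.colStochastic ℝ (Fin n)
  alignA : ∀ k, AlignedA (G k) (A k)
  alignB : ∀ k, AlignedB (G k) (B k)
  a_pos : 0 < a
  b_pos : 0 < b
  a_le : ∀ k i j, 0 < A k i j → a ≤ A k i j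
  b_le : ∀ k i j, 0 < B k i j → b ≤ B k i j

/-- `φ` is a sequence of stochastic vectors with `φ_{k+1}ᵀ A_k = φ_kᵀ`. -/
def IsAbsProbSeq {n : ℕ} (A : ℕ → Matrix (Fin n) (Fin n) ℝ) (φ : ℕ → Fin n → ℝ) : Prop :=
  (∀ k, φ k ∈ stdSimplex ℝ (Fin n)) ∧ ∀ k, φ (k + 1) ᵥ* A k = φ k

/-- `π_0 = (1/n) 𝟏` and `π_{k+1} = B_k π_k`. -/
noncomputable def piSeq {n : ℕ} (B : ℕ → Matrix (Fin n) (Fin n) ℝ) : ℕ → Fin n → ℝ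
  | 0 => fun _ => 1 / (n : ℝ)
  | k + 1 => B k *ᵥ piSeq B k

/-! ### The optimization problem -/

/-- The global cost `f = (1/n) ∑ f_i`. -/
noncomputable def avgFun {n p : ℕ} (f : Fin n → EuclideanSpace ℝ (Fin p) → ℝ)
    (x : EuclideanSpace ℝ (Fin p)) : ℝ :=
  (1 / (n : ℝ)) * ∑ i, f i x

/-- Each `f i` is continuously differentiable with `L`-Lipschitz gradient. -/
def SmoothCosts {n p : ℕ} (f : Fin n → EuclideanSpace ℝ (Fin p) → ℝ) (L : ℝ) : Prop :=
  ∀ i, ContDiff ℝ 1 (f i) ∧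
    ∀ x u, ‖gradient (f i) x - gradient (f i) u‖ ≤ L * ‖x - u‖

/-- The average `f` is `μ`-strongly convex, in gradient form. -/
def StronglyConvexAvg {n p : ℕ} (f : Fin n → EuclideanSpace ℝ (Fin p) → ℝ) (μ : ℝ) : Prop :=
  ∀ x u, μ * ‖x - u‖ ^ 2 ≤ inner ℝ (gradient (avgFun f) x - gradient (avgFun f) u) (x - u)

/-! ### The accelerated AB/Push-Pull iterates -/

/-- The state at time `k`: `xPrev = x_{k-1}`, `x = x_k`, `s = s_k`, `y = y_k`. -/
structure State (n p : ℕ) where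
  xPrev : Fin n → EuclideanSpace ℝ (Fin p)
  x : Fin n → EuclideanSpace ℝ (Fin p)
  s : Fin n → EuclideanSpace ℝ (Fin p)
  y : Fin n → EuclideanSpace ℝ (Fin p)

/-- `x_{k+1}^i = ∑_j [A_k]_{ij} s_k^j - α y_k^i + β (x_k^i - x_{k-1}^i)`. -/
noncomputable def nextX {n p : ℕ} (A : Matrix (Fin n) (Fin n) ℝ) (α β : ℝ) (σ : State n p) :
    Fin n → EuclideanSpace ℝ (Fin p) :=
  fun i => ∑ j, A i j • σ.s j - α • σ.y i + β • (σ.x i - σ.xPrev i)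

/-- `s_{k+1}^i = x_{k+1}^i + γ (x_{k+1}^i - x_k^i)`. -/
noncomputable def nextS {n p : ℕ} (A : Matrix (Fin n) (Fin n) ℝ) (α β γ : ℝ) (σ : State n p) :
    Fin n → EuclideanSpace ℝ (Fin p) :=
  fun i => nextX A α β σ i + γ • (nextX A α β σ i - σ.x i)

/-- `y_{k+1}^i = ∑_j [B_k]_{ij} y_k^j + ∇f_i(s_{k+1}^i) - ∇f_i(s_k^i)`. -/
noncomputable def nextY {n p : ℕ} (f : Fin n → EuclideanSpace ℝ (Fin p) → ℝ)
    (A B : Matrix (Fin n) (Fin n) ℝ) (α β γ : ℝ) (σ : State n p) :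
    Fin n → EuclideanSpace ℝ (Fin p) :=
  fun i => ∑ j, B i j • σ.y j + gradient (f i) (nextS A α β γ σ i) - gradient (f i) (σ.s i)

/-- The iterates started from `x_{-1}`, `x_0`, `s_0` and `y_0^i = ∇f_i(s_0^i)`. -/
noncomputable def iter {n p : ℕ} (f : Fin n → EuclideanSpace ℝ (Fin p) → ℝ)
    (A B : ℕ → Matrix (Fin n) (Fin n) ℝ) (α β γ : ℝ)
    (xInit x0 s0 : Fin n → EuclideanSpace ℝ (Fin p)) : ℕ → State n p
  | 0 => ⟨xInit, x0, s0, fun i => gradient (f i) (s0 i)⟩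
  | k + 1 =>
    let σ := iter f A B α β γ xInit x0 s0 k
    ⟨σ.x, nextX (A k) α β σ, nextS (A k) α β γ σ, nextY f (A k) (B k) α β γ σ⟩

/-! ### The four error quantities -/

/-- `‖z‖_w = √(∑ w_i ‖z_i‖²)`. -/
noncomputable def wnorm {n p : ℕ} (w : Fin n → ℝ) (z : Fin n → EuclideanSpace ℝ (Fin p)) : ℝ :=
  √(∑ i, w i * ‖z i‖ ^ 2)

/-- The weighted average `∑ w_i x_i`. -/
noncomputable def wavg {n p : ℕ} (w : Fin n → ℝ) (x : Fin n → EuclideanSpace ℝ (Fin p)) :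
    EuclideanSpace ℝ (Fin p) :=
  ∑ i, w i • x i

/-- The consensus error `D(x, φ)`. -/
noncomputable def consErr {n p : ℕ} (x : Fin n → EuclideanSpace ℝ (Fin p)) (φ : Fin n → ℝ) : ℝ :=
  wnorm φ (fun i => x i - wavg φ x)

/-- The gradient-tracking error `S(y, π)`. -/
noncomputable def trackErr {n p : ℕ} (y : Fin n → EuclideanSpace ℝ (Fin p)) (π : Fin n → ℝ) : ℝ :=
  wnorm π (fun j => (π j)⁻¹ • y j - ∑ l, y l)

/-- `V = (‖x̂ - x*‖, D(x, φ), S(y, π), ‖x - xPrev‖)`. -/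
noncomputable def errVec {n p : ℕ} (σ : State n p) (φ π : Fin n → ℝ)
    (xStar : EuclideanSpace ℝ (Fin p)) : Fin 4 → ℝ :=
  ![‖wavg φ σ.x - xStar‖, consErr σ.x φ, trackErr σ.y π, wnorm 1 (fun i => σ.x i - σ.xPrev i)]

/-! ### The constants and the matrix `M_k` -/

/-- The smallest entry of a vector. -/
noncomputable def vmin {n : ℕ} (v : Fin n → ℝ) : ℝ := ⨅ i, v i

/-- The largest entry of a vector. -/
noncomputable def vmax {n : ℕ} (v : Fin n → ℝ) : ℝ := ⨆ i, v i

/-- `φ ↦ √(1 / min φ)`. -/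
noncomputable def varphiC {n : ℕ} (φ : Fin n → ℝ) : ℝ := √(1 / vmin φ)

/-- `r_k`, as a function of `π_{k+1}`. -/
noncomputable def rC {n : ℕ} (πNext : Fin n → ℝ) : ℝ := √(n : ℝ) + 1 / √(vmin πNext)

/-- `c_k`, as a function of `𝔾_k`, `a`, `φ_k` and `φ_{k+1}`. For `n = 1` the denominator is `0`
and the value is `1`. -/
noncomputable def cC {n : ℕ} (G : Digraph (Fin n)) (a : ℝ) (φ φNext : Fin n → ℝ) : ℝ :=
  √(1 - vmin φNext * a ^ 2 / (vmax φ ^ 2 * (diameter G : ℝ) * (maxEdgeUtility G : ℝ)))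

/-- `τ_k`, as a function of `𝔾_k`, `b`, `π_k` and `π_{k+1}`. For `n = 1` the denominator is `0`
and the value is `1`. -/
noncomputable def tauC {n : ℕ} (G : Digraph (Fin n)) (b : ℝ) (π πNext : Fin n → ℝ) : ℝ :=
  √(1 - vmin π ^ 2 * b ^ 2 /
    (vmax π ^ 2 * vmax πNext * (diameter G : ℝ) * (maxEdgeUtility G : ℝ)))

/-- `q_k(α)`, as a function of `π_k`. -/
noncomputable def qC {n : ℕ} (μ L α : ℝ) (π : Fin n → ℝ) : ℝ :=
  max |1 - α * n * vmin π * μ| |1 - α * n * vmin π * L|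

/-- The matrix `M` in terms of the scalar parameters; `ϕ` and `ϕ'` stand for the constants
`√(1 / min φ)` at times `k` and `k + 1`. -/
noncomputable def matM (n : ℕ) (L α β γ q c τ r ϕ ϕ' : ℝ) : Matrix (Fin 4) (Fin 4) ℝ :=
  let m41 := α * L * √(n : ℝ) * ϕ
  let m42 := c * ϕ' + ϕ + α * L * √(n : ℝ) * ϕ
  let m43 := α
  let m44 := β + γ * √(n : ℝ) * (1 + α * L)
  !![q, α * L * √(n : ℝ) * ϕ, α, β + γ * (1 + α * L * √(n : ℝ));
     α * L * √(n : ℝ) * ϕ, c + α * L * √(n : ℝ) * ϕ, α, β + γ * (c + α * L * √(n : ℝ));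
     L * r * (1 + γ) * m41, L * r * (1 + γ) * m42, τ + L * r * (1 + γ) * m43,
       L * r * γ + L * r * (1 + γ) * m44;
     m41, m42, m43, m44]

/-- The matrix `M_k(α, β, γ)`. -/
noncomputable def stepMatrix {n : ℕ} (G : ℕ → Digraph (Fin n)) (φ π : ℕ → Fin n → ℝ)
    (a b L μ α β γ : ℝ) (k : ℕ) : Matrix (Fin 4) (Fin 4) ℝ :=
  matM n L α β γ (qC μ L α (π k)) (cC (G k) a (φ k) (φ (k + 1)))
    (tauC (G k) b (π k) (π (k + 1))) (rC (π (k + 1))) (varphiC (φ k)) (varphiC (φ (k + 1)))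

end ABPushPull

/-!
The consensus error `D_k` is a weighted standard deviation. By the law of total variance, mixing
with a row-stochastic matrix removes from the variance the average of the variances of its rows;
telescoping along shortest paths bounds this loss from below by a multiple of the variance itself,
and counting how many of the paths share an edge produces the constant
`𝖣(𝔾_k) 𝖪(𝔾_k)` of `c_k`. The tracking error `S_k` is the consensus error of the rescaled trackers
`y_k^i / [π_k]_i`, on which `B_k` acts as a row-stochastic matrix that carries the weights
`π_{k+1}` to `π_k`, so the same argument gives `τ_k`.

Since `∑ y_k^i = ∑ ∇f_i(s_k^i)` at all times, and `y_k^i ≈ [π_k]_i ∑ y_k^l` up to the tracking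
error, the average `x̂_k` performs an inexact gradient step on `f` of length `α n ⟨φ_{k+1}, π_k⟩`.
An exact step `x ↦ x - η ∇f(x)` is the gradient of `‖x‖² / 2 - η f(x)`, hence Lipschitz with
constant `max |1 - η μ| |1 - η L|`, and this is at most `q_k`. The remaining entries of `M_k` are
triangle inequalities.
-/

namespace ABPushPull

/-! ### Variance -/

section Variance

variable {ι E : Type*} [Fintype ι] [NormedAddCommGroup E] [InnerProductSpace ℝ E] {w : ι → ℝ}

theorem sum_mul_norm_sub_sq (hw : ∑ i, w i = 1) (z : ι → E) (c : E) :
    ∑ i, w i * ‖z i - c‖ ^ 2 =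
      ‖∑ i, w i • z i - c‖ ^ 2 + ∑ i, w i * ‖z i - ∑ j, w j • z j‖ ^ 2 := by
  set m := ∑ j, w j • z j with hm
  have cross : ∑ i, w i * inner ℝ (z i - m) (m - c) = 0 := by
    simp only [← real_inner_smul_left, ← sum_inner, smul_sub, Finset.sum_sub_distrib,
      ← Finset.sum_smul, hw, one_smul, ← hm, sub_self, inner_zero_left]
  have expand (i : ι) : w i * ‖z i - c‖ ^ 2 =
      w i * ‖z i - m‖ ^ 2 + 2 * (w i * inner ℝ (z i - m) (m - c)) + w i * ‖m - c‖ ^ 2 := by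
    rw [← sub_add_sub_cancel (z i) m c, norm_add_sq_real]
    ring
  simp only [expand, Finset.sum_add_distrib, ← Finset.mul_sum, ← Finset.sum_mul, cross, hw]
  ring

/-- Average `sum_mul_norm_sub_sq` over `c = z j` with the weights `w j`. -/
theorem sum_mul_norm_sub_mean_sq (hw : ∑ i, w i = 1) (z : ι → E) :
    ∑ i, w i * ‖z i - ∑ j, w j • z j‖ ^ 2 = 1 / 2 * ∑ i, ∑ j, w i * w j * ‖z i - z j‖ ^ 2 := by
  have average : ∑ i, ∑ j, w i * w j * ‖z i - z j‖ ^ 2 =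
      2 * ∑ i, w i * ‖z i - ∑ j, w j • z j‖ ^ 2 := by
    calc ∑ i, ∑ j, w i * w j * ‖z i - z j‖ ^ 2
        = ∑ i, w i * ∑ j, w j * ‖z j - z i‖ ^ 2 := by
          simp only [Finset.mul_sum, mul_assoc, norm_sub_rev]
      _ = ∑ i, w i * ‖z i - ∑ j, w j • z j‖ ^ 2 + ∑ i, w i * ‖z i - ∑ j, w j • z j‖ ^ 2 := by
          simp only [sum_mul_norm_sub_sq hw z, mul_add, Finset.sum_add_distrib, ← Finset.sum_mul,
            hw, one_mul, norm_sub_rev (z _) (∑ j, w j • z j)]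
      _ = 2 * ∑ i, w i * ‖z i - ∑ j, w j • z j‖ ^ 2 := (two_mul _).symm
  rw [average]
  ring

end Variance

/-! ### Weighted norms and averages -/

section WeightedNorm

variable {n p : ℕ} {v w : Fin n → ℝ} {z u : Fin n → EuclideanSpace ℝ (Fin p)}

theorem wnorm_nonneg : 0 ≤ wnorm w z := Real.sqrt_nonneg _

theorem wnorm_sq (hw : 0 ≤ w) : wnorm w z ^ 2 = ∑ i, w i * ‖z i‖ ^ 2 :=
  Real.sq_sqrt (Finset.sum_nonneg fun i _ => mul_nonneg (hw i) (sq_nonneg _))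

theorem wnorm_eq_norm_toLp (hw : 0 ≤ w) :
    wnorm w z = ‖(WithLp.toLp 2 (fun i => √(w i) • z i) :
      PiLp 2 (fun _ : Fin n => EuclideanSpace ℝ (Fin p)))‖ := by
  rw [PiLp.norm_eq_of_L2, wnorm]
  congr 1
  refine Finset.sum_congr rfl fun i _ => ?_
  rw [norm_smul, mul_pow, Real.norm_eq_abs, sq_abs, Real.sq_sqrt (hw i)]

theorem wnorm_add_le (hw : 0 ≤ w) : wnorm w (z + u) ≤ wnorm w z + wnorm w u := by
  simp only [wnorm_eq_norm_toLp hw]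
  refine le_trans (le_of_eq ?_) (norm_add_le _ _)
  congr 1
  ext i
  simp [smul_add]

theorem wnorm_neg : wnorm w (-z) = wnorm w z := by
  simp [wnorm]

theorem wnorm_sub_le (hw : 0 ≤ w) : wnorm w (z - u) ≤ wnorm w z + wnorm w u := by
  simpa only [sub_eq_add_neg, wnorm_neg] using wnorm_add_le (z := z) (u := -u) hw

theorem wnorm_smul (c : ℝ) : wnorm w (c • z) = |c| * wnorm w z := by
  rw [wnorm, wnorm, ← Real.sqrt_sq_eq_abs, ← Real.sqrt_mul (sq_nonneg c), Finset.mul_sum]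
  congr 1
  refine Finset.sum_congr rfl fun i _ => ?_
  rw [Pi.smul_apply, norm_smul, mul_pow, Real.norm_eq_abs, sq_abs, mul_left_comm]

theorem wnorm_const (hw : ∑ i, w i = 1) (c : EuclideanSpace ℝ (Fin p)) :
    wnorm w (fun _ => c) = ‖c‖ := by
  rw [wnorm, ← Finset.sum_mul, hw, one_mul, Real.sqrt_sq (norm_nonneg c)]

theorem wnorm_le_mul_wnorm {c : ℝ} (hc : 0 ≤ c)
    (h : ∀ i, w i * ‖z i‖ ^ 2 ≤ c ^ 2 * (v i * ‖u i‖ ^ 2)) : wnorm w z ≤ c * wnorm v u := by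
  rw [wnorm, wnorm, ← Real.sqrt_sq hc, ← Real.sqrt_mul (sq_nonneg c), Finset.mul_sum]
  exact Real.sqrt_le_sqrt (Finset.sum_le_sum fun i _ => h i)

theorem wnorm_mono (h : w ≤ v) : wnorm w z ≤ wnorm v z :=
  Real.sqrt_le_sqrt <| Finset.sum_le_sum fun i _ => mul_le_mul_of_nonneg_right (h i) (sq_nonneg _)

theorem wnorm_smul_le_wnorm (hv : v ≤ 1) (hw0 : 0 ≤ w) (hw1 : w ≤ 1) :
    wnorm v (fun i => w i • z i) ≤ wnorm w z := by
  refine Real.sqrt_le_sqrt (Finset.sum_le_sum fun i _ => ?_)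
  rw [norm_smul, mul_pow, Real.norm_eq_abs, sq_abs, ← mul_assoc]
  gcongr
  calc v i * w i ^ 2 ≤ 1 * w i ^ 2 := by gcongr; exact hv i
    _ ≤ w i := by rw [one_mul]; exact pow_le_of_le_one (hw0 i) (hw1 i) two_ne_zero

theorem norm_sum_le_sqrt_mul_wnorm_one : ‖∑ i, z i‖ ≤ √(n : ℝ) * wnorm 1 z := by
  refine (norm_sum_le _ _).trans ?_
  rw [wnorm, ← Real.sqrt_mul (Nat.cast_nonneg n)]
  refine Real.le_sqrt_of_sq_le ?_
  simpa using sq_sum_le_card_mul_sum_sq (s := Finset.univ) (f := fun i => ‖z i‖)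

theorem wnorm_one_le_sqrt_mul {c : ℝ} (hc : 0 ≤ c) (h : ∀ i, ‖z i‖ ≤ c) :
    wnorm 1 z ≤ √(n : ℝ) * c := by
  rw [wnorm, ← Real.sqrt_sq hc, ← Real.sqrt_mul (Nat.cast_nonneg n)]
  refine Real.sqrt_le_sqrt ?_
  calc ∑ i, (1 : Fin n → ℝ) i * ‖z i‖ ^ 2 ≤ ∑ _i : Fin n, c ^ 2 := by
        simp only [Pi.one_apply, one_mul]
        gcongr with i
        exact h i
    _ = n * c ^ 2 := by simp

theorem wavg_add : wavg w (z + u) = wavg w z + wavg w u := by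
  simp [wavg, Finset.sum_add_distrib]

theorem wavg_smul (c : ℝ) : wavg w (c • z) = c • wavg w z := by
  simp [wavg, Finset.smul_sum, smul_comm c]

theorem wavg_sub : wavg w (z - u) = wavg w z - wavg w u := by
  simp [wavg, smul_sub]

theorem consErr_nonneg : 0 ≤ consErr z w := wnorm_nonneg

theorem consErr_add_le (hw : 0 ≤ w) : consErr (z + u) w ≤ consErr z w + consErr u w := by
  refine le_trans (le_of_eq ?_) (wnorm_add_le hw)
  rw [consErr, wavg_add]
  congr 1
  ext1 i
  exact add_sub_add_comm _ _ _ _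

theorem consErr_smul (c : ℝ) : consErr (c • z) w = |c| * consErr z w := by
  rw [consErr, wavg_smul, consErr, ← wnorm_smul]
  congr 1
  ext1 i
  simp only [Pi.smul_apply, smul_sub]

theorem consErr_sub_le (hw : 0 ≤ w) : consErr (z - u) w ≤ consErr z w + consErr u w := by
  have h := consErr_add_le (z := z) (u := (-1 : ℝ) • u) hw
  rwa [consErr_smul, abs_neg, abs_one, one_mul, neg_one_smul, ← sub_eq_add_neg] at h

theorem wnorm_sub_const_sq (hw : w ∈ stdSimplex ℝ (Fin n)) (c : EuclideanSpace ℝ (Fin p)) :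
    wnorm w (fun i => z i - c) ^ 2 = ‖wavg w z - c‖ ^ 2 + consErr z w ^ 2 := by
  rw [consErr, wnorm_sq hw.1, wnorm_sq hw.1, sum_mul_norm_sub_sq hw.2, wavg]

theorem wnorm_sub_const_le (hw : w ∈ stdSimplex ℝ (Fin n)) (c : EuclideanSpace ℝ (Fin p)) :
    wnorm w (fun i => z i - c) ≤ ‖wavg w z - c‖ + consErr z w := by
  refine le_of_sq_le_sq ?_ (add_nonneg (norm_nonneg _) consErr_nonneg)
  rw [wnorm_sub_const_sq hw]
  nlinarith [norm_nonneg (wavg w z - c), consErr_nonneg (z := z) (w := w)]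

theorem wnorm_sq_eq_norm_wavg_sq_add (hw : w ∈ stdSimplex ℝ (Fin n)) :
    wnorm w z ^ 2 = ‖wavg w z‖ ^ 2 + consErr z w ^ 2 := by
  simpa only [sub_zero] using wnorm_sub_const_sq (z := z) hw 0

theorem norm_wavg_le_wnorm (hw : w ∈ stdSimplex ℝ (Fin n)) : ‖wavg w z‖ ≤ wnorm w z := by
  refine le_of_sq_le_sq ?_ wnorm_nonneg
  rw [wnorm_sq_eq_norm_wavg_sq_add hw]
  exact le_add_of_nonneg_right (sq_nonneg _)

theorem consErr_le_wnorm (hw : w ∈ stdSimplex ℝ (Fin n)) : consErr z w ≤ wnorm w z := by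
  refine le_of_sq_le_sq ?_ wnorm_nonneg
  rw [wnorm_sq_eq_norm_wavg_sq_add hw]
  exact le_add_of_nonneg_left (sq_nonneg _)

theorem consErr_sq (hw : w ∈ stdSimplex ℝ (Fin n)) :
    consErr z w ^ 2 = 1 / 2 * ∑ i, ∑ j, w i * w j * ‖z i - z j‖ ^ 2 := by
  rw [consErr, wnorm_sq hw.1, ← sum_mul_norm_sub_mean_sq hw.2, wavg]

theorem le_one_of_mem_stdSimplex (hw : w ∈ stdSimplex ℝ (Fin n)) : w ≤ 1 :=
  fun i => (mem_Icc_of_mem_stdSimplex hw i).2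

theorem wnorm_le_wnorm_one (hw : w ∈ stdSimplex ℝ (Fin n)) : wnorm w z ≤ wnorm 1 z :=
  wnorm_mono (le_one_of_mem_stdSimplex hw)

theorem norm_wavg_le_wnorm_one (hw : w ∈ stdSimplex ℝ (Fin n)) : ‖wavg w z‖ ≤ wnorm 1 z :=
  (norm_wavg_le_wnorm hw).trans (wnorm_le_wnorm_one hw)

theorem consErr_le_wnorm_one (hw : w ∈ stdSimplex ℝ (Fin n)) : consErr z w ≤ wnorm 1 z :=
  (consErr_le_wnorm hw).trans (wnorm_le_wnorm_one hw)

theorem vmin_le (v : Fin n → ℝ) (i : Fin n) : vmin v ≤ v i :=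
  ciInf_le (Set.finite_range v).bddBelow i

theorem le_vmax (v : Fin n → ℝ) (i : Fin n) : v i ≤ vmax v :=
  le_ciSup (Set.finite_range v).bddAbove i

end WeightedNorm

/-- Stochastic vectors with positive entries, such as the `φ_k` and `π_k` of the method. -/
structure IsPositiveStochastic {n : ℕ} (w : Fin n → ℝ) : Prop where
  pos : ∀ i, 0 < w i
  sum_eq_one : ∑ i, w i = 1

namespace IsPositiveStochastic

variable {n p : ℕ} {w : Fin n → ℝ} {z : Fin n → EuclideanSpace ℝ (Fin p)}

theorem nonneg (hw : IsPositiveStochastic w) : 0 ≤ w := fun i => (hw.pos i).le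

theorem mem_stdSimplex (hw : IsPositiveStochastic w) : w ∈ stdSimplex ℝ (Fin n) :=
  ⟨hw.nonneg, hw.sum_eq_one⟩

theorem nonempty (hw : IsPositiveStochastic w) : Nonempty (Fin n) := by
  by_contra h
  rw [not_nonempty_iff] at h
  simpa using hw.sum_eq_one

theorem vmin_pos (hw : IsPositiveStochastic w) : 0 < vmin w := by
  have := hw.nonempty
  obtain ⟨i, hi⟩ := exists_eq_ciInf_of_finite (f := w)
  exact (hw.pos i).trans_eq hi

theorem wnorm_one_le_varphiC_mul (hw : IsPositiveStochastic w) :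
    wnorm 1 z ≤ varphiC w * wnorm w z := by
  refine wnorm_le_mul_wnorm (Real.sqrt_nonneg _) fun i => ?_
  have hmin := hw.vmin_pos
  rw [varphiC, Real.sq_sqrt (by positivity), Pi.one_apply, ← mul_assoc, one_div_mul_eq_div]
  gcongr
  exact (one_le_div hmin).2 (vmin_le w i)

end IsPositiveStochastic

/-! ### Shortest paths and edge utilities -/

section Graph

variable {n : ℕ} {G : Digraph (Fin n)} {j l : Fin n} {p : List (Fin n)}
  {P : Fin n → Fin n → List (Fin n)}

theorem IsDirPath.pathLength_le (h : IsDirPath G j l p) : pathLength p ≤ n :=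
  (Nat.sub_le _ _).trans (by simpa using h.2.2.2.length_le_card)

theorem IsShortestPath.pathLength_le_diameter (hjl : j ≠ l) (h : IsShortestPath G j l p) :
    pathLength p ≤ diameter G := by
  refine le_csSup ⟨n, ?_⟩ ⟨j, l, p, hjl, h, rfl⟩
  rintro m ⟨j, l, p, -, hp, rfl⟩
  exact hp.1.pathLength_le

theorem StronglyConnected.exists_isShortestPath (hG : StronglyConnected G) (hjl : j ≠ l) :
    ∃ p, IsShortestPath G j l p := by
  obtain ⟨p, hp, hmin⟩ :=
    exists_minimalFor_of_wellFoundedLT (IsDirPath G j l) pathLength (hG j l hjl)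
  exact ⟨p, hp, fun q hq => le_of_not_gt fun hlt => hlt.not_ge (hmin hq hlt.le)⟩

theorem StronglyConnected.exists_isCovering (hG : StronglyConnected G) :
    ∃ P, IsCovering G P := by
  choose! P hP using fun j l (hjl : j ≠ l) => hG.exists_isShortestPath hjl
  exact ⟨P, hP⟩

theorem edgeUtility_le (P : Fin n → Fin n → List (Fin n)) (u v : Fin n) :
    edgeUtility P u v ≤ n * n :=
  (Set.ncard_le_card _).trans (by simp)

theorem coveringUtility_le (P : Fin n → Fin n → List (Fin n)) :
    coveringUtility G P ≤ n * n := by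
  refine csSup_le' ?_
  rintro m ⟨u, v, -, rfl⟩
  exact edgeUtility_le P u v

theorem edgeUtility_le_coveringUtility {u v : Fin n} (huv : G.Adj u v) :
    edgeUtility P u v ≤ coveringUtility G P := by
  refine le_csSup ⟨n * n, ?_⟩ ⟨u, v, huv, rfl⟩
  rintro m ⟨u, v, -, rfl⟩
  exact edgeUtility_le P u v

theorem IsCovering.coveringUtility_le_maxEdgeUtility (hP : IsCovering G P) :
    coveringUtility G P ≤ maxEdgeUtility G := by
  refine le_csSup ⟨n * n, ?_⟩ ⟨P, hP, rfl⟩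
  rintro m ⟨P, -, rfl⟩
  exact coveringUtility_le P

open Classical in
/-- The set of edges traversed by the path with node list `p`, i.e. the pairs of consecutive
nodes. -/
noncomputable def pathEdges (p : List (Fin n)) : Finset (Fin n × Fin n) :=
  {e | [e.1, e.2] <:+: p}

theorem mem_pathEdges {e : Fin n × Fin n} : e ∈ pathEdges p ↔ [e.1, e.2] <:+: p := by
  simp [pathEdges]

theorem pathEdges_singleton (c : Fin n) : pathEdges [c] = ∅ := by
  ext e
  simp [mem_pathEdges, List.infix_cons_iff, List.cons_prefix_cons]

theorem pathEdges_cons_cons (c d : Fin n) (t : List (Fin n)) :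
    pathEdges (c :: d :: t) = insert (c, d) (pathEdges (d :: t)) := by
  ext ⟨u, v⟩
  rw [Finset.mem_insert, mem_pathEdges, mem_pathEdges, List.infix_cons_iff]
  simp [List.cons_prefix_cons]

theorem card_pathEdges_le (p : List (Fin n)) : (pathEdges p).card ≤ pathLength p := by
  induction p using List.twoStepInduction with
  | nil => simp [pathEdges]
  | singleton c => simp [pathEdges_singleton]
  | cons_cons c d t _ ih =>
    rw [pathEdges_cons_cons]
    refine (Finset.card_insert_le _ _).trans ?_
    simpa [pathLength] using ih d

theorem IsDirPath.adj_of_mem_pathEdges (hp : IsDirPath G j l p) {e : Fin n × Fin n}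
    (he : e ∈ pathEdges p) : G.Adj e.1 e.2 := by
  simpa using hp.2.2.1.infix (mem_pathEdges.1 he)

theorem norm_sub_le_sum_pathEdges {E : Type*} [SeminormedAddCommGroup E] (z : Fin n → E)
    (hp : p.Nodup) (hj : p.head? = some j) (hl : p.getLast? = some l) :
    ‖z j - z l‖ ≤ ∑ e ∈ pathEdges p, ‖z e.1 - z e.2‖ := by
  induction p using List.twoStepInduction generalizing j with
  | nil => simp at hj
  | singleton c =>
    obtain rfl : c = j := by simpa using hj
    obtain rfl : c = l := by simpa using hl
    simp [pathEdges_singleton]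
  | cons_cons c d t _ ih =>
    obtain rfl : c = j := by simpa using hj
    have hc : (c, d) ∉ pathEdges (d :: t) := fun h =>
      (List.nodup_cons.1 hp).1 ((mem_pathEdges.1 h).subset (by simp))
    rw [pathEdges_cons_cons, Finset.sum_insert hc]
    have htail := ih d (List.nodup_cons.1 hp).2 rfl (by simpa using hl)
    exact (norm_sub_le_norm_sub_add_norm_sub _ (z d) _).trans (by gcongr)

theorem IsDirPath.norm_sub_sq_le {E : Type*} [SeminormedAddCommGroup E] (z : Fin n → E)
    (hp : IsDirPath G j l p) :
    ‖z j - z l‖ ^ 2 ≤ pathLength p * ∑ e ∈ pathEdges p, ‖z e.1 - z e.2‖ ^ 2 := by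
  calc ‖z j - z l‖ ^ 2 ≤ (∑ e ∈ pathEdges p, ‖z e.1 - z e.2‖) ^ 2 := by
        gcongr
        exact norm_sub_le_sum_pathEdges z hp.2.2.2 hp.1 hp.2.1
    _ ≤ (pathEdges p).card * ∑ e ∈ pathEdges p, ‖z e.1 - z e.2‖ ^ 2 := sq_sum_le_card_mul_sum_sq
    _ ≤ pathLength p * ∑ e ∈ pathEdges p, ‖z e.1 - z e.2‖ ^ 2 := by
        gcongr
        exact card_pathEdges_le p

open Classical in
theorem edgeUtility_eq_card (P : Fin n → Fin n → List (Fin n)) (e : Fin n × Fin n) :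
    edgeUtility P e.1 e.2 =
      {d ∈ (Finset.univ : Finset (Fin n)).offDiag | e ∈ pathEdges (P d.1 d.2)}.card := by
  rw [edgeUtility, ← Set.ncard_coe_finset]
  congr 1
  ext d
  simp [mem_pathEdges]

open Classical in
/-- Double counting of the incidences between the edges and the chosen paths. -/
theorem IsCovering.sum_sum_pathEdges_le (hP : IsCovering G P) {c : Fin n × Fin n → ℝ}
    (hc : 0 ≤ c) :
    ∑ d ∈ Finset.univ.offDiag, ∑ e ∈ pathEdges (P d.1 d.2), c e ≤
      maxEdgeUtility G * ∑ e with G.Adj e.1 e.2, c e := by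
  calc ∑ d ∈ Finset.univ.offDiag, ∑ e ∈ pathEdges (P d.1 d.2), c e
      = ∑ e with G.Adj e.1 e.2, ∑ d ∈ Finset.univ.offDiag with e ∈ pathEdges (P d.1 d.2), c e := by
        refine Finset.sum_comm' fun d e => ?_
        simp only [Finset.mem_filter, Finset.mem_offDiag, Finset.mem_univ, true_and]
        exact ⟨fun h => ⟨h, (hP d.1 d.2 h.1).1.adj_of_mem_pathEdges h.2⟩, fun h => h.1⟩
    _ = ∑ e with G.Adj e.1 e.2, edgeUtility P e.1 e.2 * c e := by
        simp only [Finset.sum_const, nsmul_eq_mul, edgeUtility_eq_card]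
    _ ≤ ∑ e with G.Adj e.1 e.2, maxEdgeUtility G * c e := by
        refine Finset.sum_le_sum fun e he => mul_le_mul_of_nonneg_right ?_ (hc e)
        exact_mod_cast (edgeUtility_le_coveringUtility (Finset.mem_filter.1 he).2).trans
          hP.coveringUtility_le_maxEdgeUtility
    _ = maxEdgeUtility G * ∑ e with G.Adj e.1 e.2, c e := (Finset.mul_sum _ _ _).symm

open Classical in
/-- The Dirichlet energy of `z` on `G`: the sum over the edges of the squared difference of the
values at the two endpoints. -/
noncomputable def edgeEnergy {E : Type*} [SeminormedAddCommGroup E] (G : Digraph (Fin n))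
    (z : Fin n → E) : ℝ :=
  ∑ e : Fin n × Fin n with G.Adj e.1 e.2, ‖z e.1 - z e.2‖ ^ 2

theorem edgeEnergy_nonneg {E : Type*} [SeminormedAddCommGroup E] (z : Fin n → E) :
    0 ≤ edgeEnergy G z :=
  Finset.sum_nonneg fun _ _ => sq_nonneg _

/-- The graph form of the Poincaré inequality: telescope along the paths of a covering. -/
theorem StronglyConnected.sum_norm_sub_sq_le {E : Type*} [SeminormedAddCommGroup E]
    (hG : StronglyConnected G) (z : Fin n → E) :
    ∑ j, ∑ l, ‖z j - z l‖ ^ 2 ≤ diameter G * maxEdgeUtility G * edgeEnergy G z := by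
  obtain ⟨P, hP⟩ := hG.exists_isCovering
  calc ∑ j, ∑ l, ‖z j - z l‖ ^ 2 = ∑ d ∈ Finset.univ.offDiag, ‖z d.1 - z d.2‖ ^ 2 := by
        rw [← Finset.sum_product', Finset.univ_product_univ]
        refine (Finset.sum_subset (Finset.subset_univ _) fun d _ hd => ?_).symm
        simp_all
    _ ≤ ∑ d ∈ Finset.univ.offDiag,
          diameter G * ∑ e ∈ pathEdges (P d.1 d.2), ‖z e.1 - z e.2‖ ^ 2 := by
        refine Finset.sum_le_sum fun d hd => ?_
        have hne : d.1 ≠ d.2 := (Finset.mem_offDiag.1 hd).2.2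
        refine ((hP d.1 d.2 hne).1.norm_sub_sq_le z).trans ?_
        gcongr
        exact (hP d.1 d.2 hne).pathLength_le_diameter hne
    _ ≤ diameter G * (maxEdgeUtility G * edgeEnergy G z) := by
        rw [← Finset.mul_sum]
        gcongr
        exact hP.sum_sum_pathEdges_le fun _ => sq_nonneg _
    _ = diameter G * maxEdgeUtility G * edgeEnergy G z := (mul_assoc _ _ _).symm

theorem StronglyConnected.exists_adj (hG : StronglyConnected G) {Z : Set (Fin n)}
    (hj : j ∈ Z) (hl : l ∉ Z) : ∃ i ∈ Z, ∃ i' ∉ Z, G.Adj i i' := by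
  obtain ⟨p, hhead, hlast, hchain, -⟩ := hG j l (by rintro rfl; exact hl hj)
  by_contra! hclosed
  refine hl (hchain.induction (· ∈ Z) p (fun i i' hadj hi => ?_) ?_ l (List.mem_of_getLast? hlast))
  · exact by_contra fun hi' => hclosed i hi i' hi' hadj
  · exact fun hne => by rwa [(List.head_eq_iff_head?_eq_some hne).2 hhead]

end Graph

/-! ### Contraction of the variance under mixing -/

/-- One round of mixing: each node replaces its value by the average of all values weighted by
its row of `C`. -/
noncomputable def mix {n p : ℕ} (C : Matrix (Fin n) (Fin n) ℝ)
    (z : Fin n → EuclideanSpace ℝ (Fin p)) : Fin n → EuclideanSpace ℝ (Fin p) :=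
  fun i => wavg (C i) z

section Contraction

variable {n p : ℕ} {G : Digraph (Fin n)} {w w' : Fin n → ℝ} {C : Matrix (Fin n) (Fin n) ℝ}
  {z u : Fin n → EuclideanSpace ℝ (Fin p)}

theorem mix_add : mix C (z + u) = mix C z + mix C u :=
  funext fun _ => wavg_add

theorem mix_smul (c : ℝ) : mix C (c • z) = c • mix C z :=
  funext fun _ => wavg_smul c

theorem wavg_mix (z : Fin n → EuclideanSpace ℝ (Fin p)) :
    wavg w (mix C z) = wavg (w ᵥ* C) z := by
  simp only [mix, wavg, Matrix.vecMul, dotProduct, Finset.smul_sum, Finset.sum_smul, smul_smul]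
  exact Finset.sum_comm

theorem row_mem_stdSimplex (hC : C ∈ Matrix.rowStochastic ℝ (Fin n)) (i : Fin n) :
    C i ∈ stdSimplex ℝ (Fin n) :=
  ⟨fun _ => Matrix.nonneg_of_mem_rowStochastic hC, Matrix.sum_row_of_mem_rowStochastic hC i⟩

theorem wnorm_one_mix_le (hC : C ∈ Matrix.rowStochastic ℝ (Fin n)) :
    wnorm 1 (mix C z) ≤ √(n : ℝ) * wnorm 1 z :=
  wnorm_one_le_sqrt_mul wnorm_nonneg fun i => norm_wavg_le_wnorm_one (row_mem_stdSimplex hC i)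

/-- The law of total variance: choosing a node with law `w'`, and then a second one with law the
corresponding row of `C`, gives the second node the law `w' ᵥ* C`. -/
theorem consErr_mix_sq_add (hC : C ∈ Matrix.rowStochastic ℝ (Fin n))
    (hw' : w' ∈ stdSimplex ℝ (Fin n)) (hww : w' ᵥ* C ∈ stdSimplex ℝ (Fin n)) :
    consErr (mix C z) w' ^ 2 + ∑ i, w' i * consErr z (C i) ^ 2 = consErr z (w' ᵥ* C) ^ 2 := by
  set m := wavg (w' ᵥ* C) z
  have row (i : Fin n) : ‖mix C z i - m‖ ^ 2 + consErr z (C i) ^ 2 =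
      (C *ᵥ fun j => ‖z j - m‖ ^ 2) i := by
    have hCi := row_mem_stdSimplex hC i
    rw [mix, ← wnorm_sub_const_sq hCi, wnorm_sq hCi.1, Matrix.mulVec, dotProduct]
  calc consErr (mix C z) w' ^ 2 + ∑ i, w' i * consErr z (C i) ^ 2
      = ∑ i, w' i * (‖mix C z i - m‖ ^ 2 + consErr z (C i) ^ 2) := by
        simp only [mul_add, Finset.sum_add_distrib]
        rw [consErr, wnorm_sq hw'.1, wavg_mix]
    _ = w' ⬝ᵥ C *ᵥ fun j => ‖z j - m‖ ^ 2 := by simp only [row, dotProduct]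
    _ = consErr z (w' ᵥ* C) ^ 2 := by
        rw [Matrix.dotProduct_mulVec, consErr, wnorm_sq hww.1, dotProduct]

theorem half_sum_mul_norm_sub_sq_le_consErr_sq (hw : w ∈ stdSimplex ℝ (Fin n)) (i : Fin n) :
    1 / 2 * ∑ j, w i * w j * ‖z i - z j‖ ^ 2 ≤ consErr z w ^ 2 := by
  rw [consErr_sq hw]
  refine mul_le_mul_of_nonneg_left ?_ (by norm_num)
  refine Finset.single_le_sum (f := fun i => ∑ j, w i * w j * ‖z i - z j‖ ^ 2)
    (fun k _ => Finset.sum_nonneg fun j _ => ?_) (Finset.mem_univ i)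
  exact mul_nonneg (mul_nonneg (hw.1 k) (hw.1 j)) (sq_nonneg _)

theorem mul_edgeEnergy_le_sum_consErr_sq (hC : C ∈ Matrix.rowStochastic ℝ (Fin n)) (hw' : 0 ≤ w')
    {δ : ℝ} (hδ : ∀ i j, G.Adj j i → δ ≤ w' i * (C i i * C i j)) :
    δ / 2 * edgeEnergy G z ≤ ∑ i, w' i * consErr z (C i) ^ 2 := by
  classical
  rw [edgeEnergy, Finset.sum_filter, Fintype.sum_prod_type_right, Finset.mul_sum]
  refine Finset.sum_le_sum fun i _ => ?_
  have hCi := row_mem_stdSimplex hC i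
  calc δ / 2 * ∑ j, (if G.Adj j i then ‖z j - z i‖ ^ 2 else 0)
      = 1 / 2 * ∑ j, δ * (if G.Adj j i then ‖z i - z j‖ ^ 2 else 0) := by
        rw [← Finset.mul_sum]
        simp only [norm_sub_rev (z i)]
        ring
    _ ≤ 1 / 2 * ∑ j, w' i * (C i i * C i j * ‖z i - z j‖ ^ 2) := by
        refine mul_le_mul_of_nonneg_left (Finset.sum_le_sum fun j _ => ?_) (by norm_num)
        split_ifs with hji
        · rw [← mul_assoc]
          gcongr
          exact hδ i j hji
        · rw [mul_zero]
          exact mul_nonneg (hw' i) (mul_nonneg (mul_nonneg (hCi.1 i) (hCi.1 j)) (sq_nonneg _))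
    _ = w' i * (1 / 2 * ∑ j, C i i * C i j * ‖z i - z j‖ ^ 2) := by
        rw [← Finset.mul_sum, mul_left_comm]
    _ ≤ w' i * consErr z (C i) ^ 2 :=
        mul_le_mul_of_nonneg_left (half_sum_mul_norm_sub_sq_le_consErr_sq hCi i) (hw' i)

theorem consErr_sq_le_mul_edgeEnergy (hG : StronglyConnected G) (hw : w ∈ stdSimplex ℝ (Fin n)) :
    consErr z w ^ 2 ≤
      vmax w ^ 2 * diameter G * maxEdgeUtility G * (1 / 2 * edgeEnergy G z) := by
  calc consErr z w ^ 2 = 1 / 2 * ∑ i, ∑ j, w i * w j * ‖z i - z j‖ ^ 2 := consErr_sq hw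
    _ ≤ 1 / 2 * ∑ i, ∑ j, vmax w ^ 2 * ‖z i - z j‖ ^ 2 := by
        gcongr with i _ j
        rw [sq]
        exact mul_le_mul (le_vmax w i) (le_vmax w j) (hw.1 j) ((hw.1 i).trans (le_vmax w i))
    _ = 1 / 2 * (vmax w ^ 2 * ∑ i, ∑ j, ‖z i - z j‖ ^ 2) := by simp only [Finset.mul_sum]
    _ ≤ 1 / 2 * (vmax w ^ 2 * (diameter G * maxEdgeUtility G * edgeEnergy G z)) := by
        gcongr
        exact hG.sum_norm_sub_sq_le z
    _ = vmax w ^ 2 * diameter G * maxEdgeUtility G * (1 / 2 * edgeEnergy G z) := by ring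

theorem consErr_mix_le_sqrt_mul (hG : StronglyConnected G) (hC : C ∈ Matrix.rowStochastic ℝ (Fin n))
    (hw' : w' ∈ stdSimplex ℝ (Fin n)) (hww : w' ᵥ* C = w) (hw : w ∈ stdSimplex ℝ (Fin n))
    {δ : ℝ} (hδ0 : 0 ≤ δ) (hδ : ∀ i j, G.Adj j i → δ ≤ w' i * (C i i * C i j)) :
    consErr (mix C z) w' ≤
      √(1 - δ / (vmax w ^ 2 * diameter G * maxEdgeUtility G)) * consErr z w := by
  set κ : ℝ := vmax w ^ 2 * diameter G * maxEdgeUtility G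
  have hκ : 0 ≤ κ := by positivity
  have henergy := edgeEnergy_nonneg (G := G) z
  have hloss : δ / κ * consErr z w ^ 2 ≤ ∑ i, w' i * consErr z (C i) ^ 2 :=
    calc δ / κ * consErr z w ^ 2 ≤ δ / κ * (κ * (1 / 2 * edgeEnergy G z)) := by
          gcongr
          exact consErr_sq_le_mul_edgeEnergy hG hw
      _ ≤ δ * (1 / 2 * edgeEnergy G z) := by
          rw [← mul_assoc]
          gcongr
          exact (div_mul_eq_mul_div δ κ κ).trans_le (div_le_of_le_mul₀ hκ hδ0 le_rfl)
      _ = δ / 2 * edgeEnergy G z := by ring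
      _ ≤ ∑ i, w' i * consErr z (C i) ^ 2 := mul_edgeEnergy_le_sum_consErr_sq hC hw'.1 hδ
  rw [← Real.sqrt_sq (consErr_nonneg (z := z) (w := w)), ← Real.sqrt_mul' _ (sq_nonneg _)]
  refine Real.le_sqrt_of_sq_le ?_
  subst hww
  linarith [consErr_mix_sq_add (z := z) hC hw' hw]

theorem AlignedA.diag_pos (hCG : AlignedA G C) (i : Fin n) : 0 < C i i :=
  (hCG i i).1 (Or.inr rfl)

theorem AlignedA.consErr_mix_le (hCG : AlignedA G C) (hG : StronglyConnected G)
    (hC : C ∈ Matrix.rowStochastic ℝ (Fin n)) (hw' : w' ∈ stdSimplex ℝ (Fin n))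
    (hww : w' ᵥ* C = w) (hw : w ∈ stdSimplex ℝ (Fin n)) {a : ℝ} (ha : 0 ≤ a)
    (haC : ∀ i j, 0 < C i j → a ≤ C i j) :
    consErr (mix C z) w' ≤ cC G a w w' * consErr z w := by
  have hmin : 0 ≤ vmin w' := Real.iInf_nonneg hw'.1
  refine consErr_mix_le_sqrt_mul hG hC hw' hww hw (by positivity) fun i j hji => ?_
  have hii := haC i i (hCG.diag_pos i)
  have hij := haC i j ((hCG i j).1 (Or.inl hji))
  rw [sq]
  exact mul_le_mul (vmin_le w' i) (mul_le_mul hii hij ha (ha.trans hii)) (by positivity) (hw'.1 i)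

end Contraction

/-! ### Contraction of the tracking error -/

/-- The matrix that acts on the scaled values `(w i)⁻¹ • y i` as `B` acts on the `y i`; it is
row-stochastic whatever the column sums of `B` are. -/
noncomputable def rescale {n : ℕ} (B : Matrix (Fin n) (Fin n) ℝ) (w : Fin n → ℝ) :
    Matrix (Fin n) (Fin n) ℝ :=
  Matrix.of fun i j => B i j * w j / (B *ᵥ w) i

section Tracking

variable {n p : ℕ} {G : Digraph (Fin n)} {w : Fin n → ℝ} {B : Matrix (Fin n) (Fin n) ℝ}
  {y : Fin n → EuclideanSpace ℝ (Fin p)}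

theorem rescale_mem_rowStochastic (hB : ∀ i j, 0 ≤ B i j) (hw : 0 ≤ w)
    (hBw : ∀ i, 0 < (B *ᵥ w) i) : rescale B w ∈ Matrix.rowStochastic ℝ (Fin n) := by
  rw [Matrix.mem_rowStochastic_iff_sum]
  refine ⟨fun i j => div_nonneg (mul_nonneg (hB i j) (hw j)) (hBw i).le, fun i => ?_⟩
  simp only [rescale, Matrix.of_apply]
  rw [← Finset.sum_div]
  exact div_self (hBw i).ne'

theorem mulVec_vecMul_rescale (hB : B ∈ Matrix.colStochastic ℝ (Fin n))
    (hBw : ∀ i, 0 < (B *ᵥ w) i) : (B *ᵥ w) ᵥ* rescale B w = w := by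
  ext j
  calc ((B *ᵥ w) ᵥ* rescale B w) j = ∑ i, (B *ᵥ w) i * rescale B w i j := rfl
    _ = ∑ i, B i j * w j := Finset.sum_congr rfl fun i _ => mul_div_cancel₀ _ (hBw i).ne'
    _ = w j := by rw [← Finset.sum_mul, Matrix.sum_col_of_mem_colStochastic hB, one_mul]

theorem mix_rescale (hw : ∀ i, 0 < w i) :
    mix (rescale B w) (fun i => (w i)⁻¹ • y i) = fun i => ((B *ᵥ w) i)⁻¹ • mix B y i := by
  ext1 i
  simp only [mix, wavg, Finset.smul_sum, smul_smul, rescale, Matrix.of_apply]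
  refine Finset.sum_congr rfl fun j _ => ?_
  rw [div_mul_eq_mul_div, mul_inv_cancel_right₀ (hw j).ne', inv_mul_eq_div]

theorem trackErr_eq_consErr (hw : ∀ i, 0 < w i) :
    trackErr y w = consErr (fun i => (w i)⁻¹ • y i) w := by
  have havg : wavg w (fun i => (w i)⁻¹ • y i) = ∑ l, y l :=
    Finset.sum_congr rfl fun i _ => smul_inv_smul₀ (hw i).ne' _
  rw [trackErr, consErr, havg]

theorem AlignedB.diag_pos (hBG : AlignedB G B) (i : Fin n) : 0 < B i i :=
  (hBG i i).1 (Or.inr rfl)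

theorem AlignedB.div_vmax_le_mul_rescale (hBG : AlignedB G B) (hw : ∀ i, 0 < w i)
    (hBw : ∀ i, 0 < (B *ᵥ w) i) {b : ℝ} (hb : 0 ≤ b) (hbB : ∀ i j, 0 < B i j → b ≤ B i j)
    {i j : Fin n} (hji : G.Adj j i) :
    vmin w ^ 2 * b ^ 2 / vmax (B *ᵥ w) ≤
      (B *ᵥ w) i * (rescale B w i i * rescale B w i j) := by
  have hmin : 0 ≤ vmin w := Real.iInf_nonneg fun i => (hw i).le
  have hii := hbB i i (hBG.diag_pos i)
  have hij := hbB i j ((hBG j i).1 (Or.inl hji))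
  calc vmin w ^ 2 * b ^ 2 / vmax (B *ᵥ w) = vmin w * vmin w * (b * b) / vmax (B *ᵥ w) := by
        rw [sq, sq]
    _ ≤ w i * w j * (B i i * B i j) / (B *ᵥ w) i := by
        have hww : vmin w * vmin w ≤ w i * w j :=
          mul_le_mul (vmin_le w i) (vmin_le w j) hmin (hw i).le
        have hBB : b * b ≤ B i i * B i j := mul_le_mul hii hij hb (hb.trans hii)
        have hww_nonneg : 0 ≤ w i * w j := (mul_pos (hw i) (hw j)).le
        exact div_le_div₀ (mul_nonneg hww_nonneg ((mul_nonneg hb hb).trans hBB))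
          (mul_le_mul hww hBB (mul_nonneg hb hb) hww_nonneg) (hBw i) (le_vmax _ i)
    _ = (B *ᵥ w) i * (rescale B w i i * rescale B w i j) := by
        have hBwi := (hBw i).ne'
        simp only [rescale, Matrix.of_apply]
        field_simp

theorem AlignedB.trackErr_mix_le (hBG : AlignedB G B) (hG : StronglyConnected G)
    (hB : B ∈ Matrix.colStochastic ℝ (Fin n)) (hw : IsPositiveStochastic w)
    (hBw : IsPositiveStochastic (B *ᵥ w)) {b : ℝ} (hb : 0 ≤ b)
    (hbB : ∀ i j, 0 < B i j → b ≤ B i j) :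
    trackErr (mix B y) (B *ᵥ w) ≤ tauC G b w (B *ᵥ w) * trackErr y w := by
  have hmax : 0 ≤ vmax (B *ᵥ w) := Real.iSup_nonneg hBw.nonneg
  have hfactor : vmin w ^ 2 * b ^ 2 / vmax (B *ᵥ w) /
      (vmax w ^ 2 * diameter G * maxEdgeUtility G) = vmin w ^ 2 * b ^ 2 /
        (vmax w ^ 2 * vmax (B *ᵥ w) * diameter G * maxEdgeUtility G) := by
    rw [div_div]
    ring_nf
  rw [trackErr_eq_consErr hBw.pos, trackErr_eq_consErr hw.pos, ← mix_rescale hw.pos, tauC,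
    ← hfactor]
  exact consErr_mix_le_sqrt_mul hG
    (rescale_mem_rowStochastic (fun _ _ => Matrix.nonneg_of_mem_colStochastic hB) hw.nonneg hBw.pos)
    hBw.mem_stdSimplex (mulVec_vecMul_rescale hB hBw.pos) hw.mem_stdSimplex (by positivity)
    fun i j => hBG.div_vmax_le_mul_rescale hw.pos hBw.pos hb hbB

end Tracking

/-! ### Positivity of the weight sequences -/

section Positivity

theorem eq_empty_of_ssubset_succ {ι : Type*} [Finite ι] {Z : ℕ → Set ι}
    (hZ : ∀ k, (Z k).Nonempty → Z k ⊂ Z (k + 1)) (k : ℕ) : Z k = ∅ := by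
  by_contra hk
  have hne (m : ℕ) : (Z (k + m)).Nonempty := by
    induction m with
    | zero => exact Set.nonempty_iff_ne_empty.2 hk
    | succ m ih => exact ih.mono (hZ _ ih).subset
  exact not_injective_infinite_finite (fun m => Z (k + m))
    (strictMono_nat_of_lt_succ fun m => hZ (k + m) (hne m)).injective

variable {n : ℕ} {A B : ℕ → Matrix (Fin n) (Fin n) ℝ} {φ : ℕ → Fin n → ℝ}

theorem AlignedA.zeros_ssubset {G : Digraph (Fin n)} {C : Matrix (Fin n) (Fin n) ℝ}
    {w : Fin n → ℝ} (hCG : AlignedA G C) (hG : StronglyConnected G)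
    (hC : C ∈ Matrix.rowStochastic ℝ (Fin n)) (hw : 0 ≤ w) (hne : w ᵥ* C ≠ 0)
    (hzero : {i | (w ᵥ* C) i = 0}.Nonempty) : {i | (w ᵥ* C) i = 0} ⊂ {i | w i = 0} := by
  have propagate {i j : Fin n} (hi : (w ᵥ* C) i = 0) (hji : 0 < C j i) : w j = 0 := by
    have hterms (l : Fin n) (_ : l ∈ Finset.univ) : 0 ≤ w l * C l i :=
      mul_nonneg (hw l) (Matrix.nonneg_of_mem_rowStochastic hC)
    have hterm : w j * C j i = 0 :=
      (Finset.sum_eq_zero_iff_of_nonneg hterms).1 hi j (Finset.mem_univ j)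
    exact (mul_eq_zero.1 hterm).resolve_right hji.ne'
  obtain ⟨i, hi⟩ := hzero
  obtain ⟨l, hl⟩ := Function.ne_iff.1 hne
  obtain ⟨u, hu, v, hv, huv⟩ := hG.exists_adj (Z := {i | (w ᵥ* C) i = 0}) hi hl
  refine (Set.ssubset_iff_of_subset fun j hj => propagate hj (hCG.diag_pos j)).2 ⟨v, ?_, hv⟩
  exact propagate hu ((hCG v u).1 (Or.inl huv))

theorem IsAbsProbSeq.isPositiveStochastic (hφ : IsAbsProbSeq A φ) {G : ℕ → Digraph (Fin n)}
    (hG : ∀ k, StronglyConnected (G k)) (hA : ∀ k, A k ∈ Matrix.rowStochastic ℝ (Fin n))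
    (hAG : ∀ k, AlignedA (G k) (A k)) (k : ℕ) : IsPositiveStochastic (φ k) := by
  refine ⟨fun i => ((hφ.1 k).1 i).lt_of_ne' fun hi => ?_, (hφ.1 k).2⟩
  have hempty : {i | φ k i = 0} = ∅ := by
    refine eq_empty_of_ssubset_succ (Z := fun k => {i | φ k i = 0}) (fun m hm => ?_) k
    rw [← hφ.2 m] at hm ⊢
    refine (hAG m).zeros_ssubset (hG m) (hA m) (hφ.1 (m + 1)).1 (fun h0 => ?_) hm
    simpa [← hφ.2 m, h0] using (hφ.1 m).2
  exact hempty.subset hi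

theorem IsPositiveStochastic.mulVec {C : Matrix (Fin n) (Fin n) ℝ} {w : Fin n → ℝ}
    (hw : IsPositiveStochastic w) (hC : C ∈ Matrix.colStochastic ℝ (Fin n))
    (hdiag : ∀ i, 0 < C i i) : IsPositiveStochastic (C *ᵥ w) where
  pos i := by
    refine Finset.sum_pos' (fun j _ => ?_) ⟨i, Finset.mem_univ i, mul_pos (hdiag i) (hw.pos i)⟩
    exact mul_nonneg (Matrix.nonneg_of_mem_colStochastic hC) (hw.nonneg j)
  sum_eq_one := by rw [Matrix.sum_mulVec_of_mem_colStochastic hC, hw.sum_eq_one]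

theorem isPositiveStochastic_piSeq (hn : 1 ≤ n) (hB : ∀ k, B k ∈ Matrix.colStochastic ℝ (Fin n))
    (hdiag : ∀ k i, 0 < B k i i) (k : ℕ) : IsPositiveStochastic (piSeq B k) := by
  induction k with
  | zero =>
    have hn' : (0 : ℝ) < n := by exact_mod_cast hn
    exact ⟨fun _ => one_div_pos.2 hn', by simp [piSeq, hn'.ne']⟩
  | succ k ih => exact ih.mulVec (hB k) (hdiag k)

end Positivity

/-! ### Gradient steps -/

section GradientStep

variable {F : Type*} [NormedAddCommGroup F] [InnerProductSpace ℝ F] [CompleteSpace F]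
  {f : F → ℝ} {g : F → F} {q μ L : ℝ}

theorem gradient_eq_zero_of_isLocalMin {x : F} (h : IsLocalMin f x) : gradient f x = 0 := by
  rw [gradient, h.fderiv_eq_zero, map_zero]

theorem hasDerivAt_comp_line (hf : ∀ x, HasGradientAt f (g x) x) (x d : F) (t : ℝ) :
    HasDerivAt (fun t : ℝ => f (x + t • d)) (inner ℝ (g (x + t • d)) d) t := by
  have hline : HasDerivAt (fun t : ℝ => x + t • d) d t := by
    simpa using ((hasDerivAt_id t).smul_const d).const_add x
  exact ((hf (x + t • d)).hasFDerivAt.comp_hasDerivAt t hline).congr_deriv (by simp)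

theorem le_add_inner_add_of_inner_sub_le (hf : ∀ x, HasGradientAt f (g x) x)
    (hg : ∀ x u, inner ℝ (g x - g u) (x - u) ≤ q * ‖x - u‖ ^ 2) (x d : F) :
    f (x + d) ≤ f x + inner ℝ (g x) d + q / 2 * ‖d‖ ^ 2 := by
  set gap : ℝ → ℝ := fun t => f (x + t • d) - (t * inner ℝ (g x) d + q / 2 * ‖d‖ ^ 2 * t ^ 2)
  have hgap (t : ℝ) :
      HasDerivAt gap (inner ℝ (g (x + t • d) - g x) d - q * ‖d‖ ^ 2 * t) t := by
    have hquad := ((hasDerivAt_id t).mul_const (inner ℝ (g x) d)).add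
      ((hasDerivAt_pow 2 t).const_mul (q / 2 * ‖d‖ ^ 2))
    refine ((hasDerivAt_comp_line hf x d t).sub hquad).congr_deriv ?_
    rw [inner_sub_left]
    push_cast
    ring
  have hanti : AntitoneOn gap (Set.Icc 0 1) := by
    refine antitoneOn_of_deriv_nonpos (convex_Icc 0 1)
      (fun t _ => (hgap t).continuousAt.continuousWithinAt)
      (fun t _ => (hgap t).differentiableAt.differentiableWithinAt) fun t ht => ?_
    rw [interior_Icc] at ht
    rw [(hgap t).deriv, sub_nonpos]
    have hslope := hg (x + t • d) x
    rw [add_sub_cancel_left, real_inner_smul_right, norm_smul,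
      Real.norm_of_nonneg ht.1.le] at hslope
    exact le_of_mul_le_mul_left (hslope.trans_eq (by ring)) ht.1
  have hend := hanti (Set.left_mem_Icc.2 zero_le_one) (Set.right_mem_Icc.2 zero_le_one) zero_le_one
  simp only [gap, zero_smul, one_smul, add_zero] at hend
  linarith

theorem add_inner_sub_le_of_neg_le_inner_sub (hf : ∀ x, HasGradientAt f (g x) x)
    (hg : ∀ x u, -(q * ‖x - u‖ ^ 2) ≤ inner ℝ (g x - g u) (x - u)) (x d : F) :
    f x + inner ℝ (g x) d - q / 2 * ‖d‖ ^ 2 ≤ f (x + d) := by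
  have hneg (x : F) : HasGradientAt (-f) ((-g) x) x := by
    rw [hasGradientAt_iff_hasFDerivAt, Pi.neg_apply, map_neg]
    exact (hf x).hasFDerivAt.neg
  have h := le_add_inner_add_of_inner_sub_le (q := q) hneg (fun x u => ?_) x d
  · simp only [Pi.neg_apply, inner_neg_left] at h
    linarith
  · rw [Pi.neg_apply, Pi.neg_apply, neg_sub_neg, ← neg_sub, inner_neg_left, neg_le]
    exact hg x u

/-- Compare the quadratic models of `f` around `x` and `u` at the two points `u + w` and `x - w`,
where `w` is the midpoint of `x - u` and `v`. -/
theorem two_mul_inner_sub_le (hf : ∀ x, HasGradientAt f (g x) x)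
    (hg : ∀ x u, |inner ℝ (g x - g u) (x - u)| ≤ q * ‖x - u‖ ^ 2) (x u v : F) :
    2 * inner ℝ (g x - g u) v ≤ q * (‖x - u‖ ^ 2 + ‖v‖ ^ 2) := by
  have hupper := le_add_inner_add_of_inner_sub_le hf fun x u => (abs_le.1 (hg x u)).2
  have hlower := add_inner_sub_le_of_neg_le_inner_sub hf fun x u => (abs_le.1 (hg x u)).1
  set w : F := (1 / 2 : ℝ) • (x - u + v) with hw
  set w' : F := (1 / 2 : ℝ) • (x - u - v) with hw'
  have hu : x + -w' = u + w := by rw [hw, hw']; module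
  have hx : u + w' = x + -w := by rw [hw, hw']; module
  have hparallelogram : ‖w‖ ^ 2 + ‖w'‖ ^ 2 = (‖x - u‖ ^ 2 + ‖v‖ ^ 2) / 2 := by
    simp only [hw, hw', norm_smul, mul_pow, norm_add_sq_real, norm_sub_sq_real (x - u) v]
    norm_num
    ring
  have hinner : inner ℝ (g x - g u) w - inner ℝ (g x - g u) w' = inner ℝ (g x - g u) v := by
    rw [← inner_sub_right]
    congr 1
    rw [hw, hw']
    module
  have hxu := hx ▸ hlower u w'
  have hux := hu ▸ hlower x (-w')
  have huu := hupper u w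
  have hxx := hupper x (-w)
  simp only [inner_neg_right, norm_neg] at hux hxx
  simp only [inner_sub_left] at hinner ⊢
  linear_combination 2 * (hxu + hux + huu + hxx) - 2 * hinner + 2 * q * hparallelogram

theorem norm_sub_le_of_abs_inner_sub_le (hf : ∀ x, HasGradientAt f (g x) x)
    (hg : ∀ x u, |inner ℝ (g x - g u) (x - u)| ≤ q * ‖x - u‖ ^ 2) (x u : F) :
    ‖g x - g u‖ ≤ q * ‖x - u‖ := by
  have key := two_mul_inner_sub_le hf hg x u
  set Δ := g x - g u
  rcases eq_or_ne x u with rfl | hxu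
  · simp [Δ]
  have hr : 0 < ‖x - u‖ := norm_sub_pos_iff.2 hxu
  set r := ‖x - u‖
  rcases (norm_nonneg Δ).eq_or_lt' with hΔ | hΔ
  · have h := key 0
    rw [inner_zero_right, norm_zero] at h
    rw [hΔ]
    nlinarith
  · have h := key ((r / ‖Δ‖) • Δ)
    rw [real_inner_smul_right, real_inner_self_eq_norm_sq, norm_smul,
      Real.norm_of_nonneg (div_pos hr hΔ).le, div_mul_cancel₀ _ hΔ.ne'] at h
    have hleft : r / ‖Δ‖ * ‖Δ‖ ^ 2 = ‖Δ‖ * r := by field_simp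
    rw [hleft] at h
    exact le_of_mul_le_mul_right (by linarith) hr

/-- The map `x ↦ x - η • g x` is the gradient of `‖x‖ ^ 2 / 2 - η * f x`, to which
`norm_sub_le_of_abs_inner_sub_le` applies. -/
theorem norm_sub_smul_gradient_sub_le (hf : ∀ x, HasGradientAt f (g x) x)
    (hμ : ∀ x u, μ * ‖x - u‖ ^ 2 ≤ inner ℝ (g x - g u) (x - u))
    (hL : ∀ x u, inner ℝ (g x - g u) (x - u) ≤ L * ‖x - u‖ ^ 2) {η : ℝ} (hη : 0 ≤ η) (x u : F) :
    ‖(x - η • g x) - (u - η • g u)‖ ≤ max |1 - η * μ| |1 - η * L| * ‖x - u‖ := by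
  have hstep (x : F) : HasGradientAt (fun x => 1 / 2 * ‖x‖ ^ 2 - η * f x) (x - η • g x) x := by
    rw [hasGradientAt_iff_hasFDerivAt]
    refine (((hasStrictFDerivAt_norm_sq x).hasFDerivAt.const_mul (1 / 2)).sub
      ((hf x).hasFDerivAt.const_mul η)).congr_fderiv ?_
    ext v
    simp
  refine norm_sub_le_of_abs_inner_sub_le hstep (fun x u => ?_) x u
  have hinner : inner ℝ ((x - η • g x) - (u - η • g u)) (x - u) =
      ‖x - u‖ ^ 2 - η * inner ℝ (g x - g u) (x - u) := by
    rw [sub_sub_sub_comm, ← smul_sub, inner_sub_left, real_inner_self_eq_norm_sq,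
      real_inner_smul_left]
  have hlower : (1 - η * L) * ‖x - u‖ ^ 2 ≤ ‖x - u‖ ^ 2 - η * inner ℝ (g x - g u) (x - u) := by
    linarith [mul_le_mul_of_nonneg_left (hL x u) hη]
  have hupper : ‖x - u‖ ^ 2 - η * inner ℝ (g x - g u) (x - u) ≤ (1 - η * μ) * ‖x - u‖ ^ 2 := by
    linarith [mul_le_mul_of_nonneg_left (hμ x u) hη]
  rw [hinner, max_comm]
  refine (abs_le_max_abs_abs hlower hupper).trans_eq ?_
  rw [abs_mul, abs_mul, abs_of_nonneg (sq_nonneg ‖x - u‖), max_mul_of_nonneg _ _ (sq_nonneg _)]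

end GradientStep

/-! ### The average cost -/

section AverageCost

variable {n p : ℕ} {f : Fin n → EuclideanSpace ℝ (Fin p) → ℝ} {L : ℝ}

namespace SmoothCosts

theorem hasGradientAt (hf : SmoothCosts f L) (i : Fin n) (x : EuclideanSpace ℝ (Fin p)) :
    HasGradientAt (f i) (gradient (f i) x) x :=
  ((hf i).1.differentiable one_ne_zero x).hasGradientAt

theorem hasGradientAt_avgFun (hf : SmoothCosts f L) (x : EuclideanSpace ℝ (Fin p)) :
    HasGradientAt (avgFun f) ((1 / (n : ℝ)) • ∑ i, gradient (f i) x) x := by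
  rw [hasGradientAt_iff_hasFDerivAt, map_smul, map_sum]
  exact (HasFDerivAt.fun_sum fun i _ => (hf.hasGradientAt i x).hasFDerivAt).const_mul _

theorem sum_gradient (hf : SmoothCosts f L) (x : EuclideanSpace ℝ (Fin p)) :
    ∑ i, gradient (f i) x = (n : ℝ) • gradient (avgFun f) x := by
  rw [(hf.hasGradientAt_avgFun x).gradient]
  rcases eq_or_ne n 0 with rfl | hn
  · simp
  · rw [smul_smul, mul_one_div_cancel (Nat.cast_ne_zero.2 hn), one_smul]

theorem inner_gradient_avgFun_sub_le (hf : SmoothCosts f L) (hL : 0 ≤ L)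
    (x u : EuclideanSpace ℝ (Fin p)) :
    inner ℝ (gradient (avgFun f) x - gradient (avgFun f) u) (x - u) ≤ L * ‖x - u‖ ^ 2 := by
  rw [(hf.hasGradientAt_avgFun x).gradient, (hf.hasGradientAt_avgFun u).gradient, ← smul_sub,
    ← Finset.sum_sub_distrib, real_inner_smul_left, sum_inner]
  calc 1 / (n : ℝ) * ∑ i, inner ℝ (gradient (f i) x - gradient (f i) u) (x - u)
      ≤ 1 / (n : ℝ) * ∑ _i : Fin n, L * ‖x - u‖ * ‖x - u‖ := by
        gcongr with i
        exact (real_inner_le_norm _ _).trans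
          (mul_le_mul_of_nonneg_right ((hf i).2 x u) (norm_nonneg _))
    _ = (n : ℝ)⁻¹ * n * (L * ‖x - u‖ ^ 2) := by
        rw [Finset.sum_const, Finset.card_fin, nsmul_eq_mul]
        ring
    _ ≤ L * ‖x - u‖ ^ 2 := mul_le_of_le_one_left (by positivity) inv_mul_le_one

theorem wnorm_one_gradient_sub_le (hf : SmoothCosts f L) (hL : 0 ≤ L)
    (s u : Fin n → EuclideanSpace ℝ (Fin p)) :
    wnorm 1 (fun i => gradient (f i) (s i) - gradient (f i) (u i)) ≤ L * wnorm 1 (s - u) := by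
  refine wnorm_le_mul_wnorm hL fun i => ?_
  simpa [mul_pow] using pow_le_pow_left₀ (norm_nonneg _) ((hf i).2 (s i) (u i)) 2

theorem norm_sum_gradient_sub_le (hf : SmoothCosts f L) (hL : 0 ≤ L)
    (s u : Fin n → EuclideanSpace ℝ (Fin p)) :
    ‖∑ i, gradient (f i) (s i) - ∑ i, gradient (f i) (u i)‖ ≤
      L * √(n : ℝ) * wnorm 1 (s - u) := by
  rw [← Finset.sum_sub_distrib]
  refine norm_sum_le_sqrt_mul_wnorm_one.trans ?_
  rw [mul_comm L, mul_assoc]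
  gcongr
  exact hf.wnorm_one_gradient_sub_le hL s u

end SmoothCosts

end AverageCost

/-! ### The factor `q_k` -/

section StepSize

variable {n p : ℕ} {v w : Fin n → ℝ}

theorem vmin_le_dotProduct (hv : v ∈ stdSimplex ℝ (Fin n)) : vmin w ≤ v ⬝ᵥ w := by
  calc vmin w = ∑ i, v i * vmin w := by rw [← Finset.sum_mul, hv.2, one_mul]
    _ ≤ ∑ i, v i * w i :=
        Finset.sum_le_sum fun i _ => mul_le_mul_of_nonneg_left (vmin_le w i) (hv.1 i)

theorem dotProduct_le_of_forall_le (hv : v ∈ stdSimplex ℝ (Fin n)) {c : ℝ} (hw : ∀ i, w i ≤ c) :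
    v ⬝ᵥ w ≤ c := by
  calc v ⬝ᵥ w ≤ ∑ i, v i * c :=
        Finset.sum_le_sum fun i _ => mul_le_mul_of_nonneg_left (hw i) (hv.1 i)
    _ = c := by rw [← Finset.sum_mul, hv.2, one_mul]

theorem vmax_le_vmin_or_vmax_add_vmin_le_one (hw : IsPositiveStochastic w) :
    vmax w ≤ vmin w ∨ vmax w + vmin w ≤ 1 := by
  have := hw.nonempty
  obtain ⟨i, hi⟩ := exists_eq_ciSup_of_finite (f := w)
  obtain ⟨j, hj⟩ := exists_eq_ciInf_of_finite (f := w)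
  change w i = vmax w at hi
  change w j = vmin w at hj
  rw [← hi, ← hj]
  rcases eq_or_ne i j with rfl | hij
  · exact Or.inl le_rfl
  · rw [← hw.sum_eq_one, ← Finset.sum_pair hij]
    exact Or.inr (Finset.sum_le_sum_of_subset_of_nonneg (Finset.subset_univ _)
      fun l _ _ => hw.nonneg l)

theorem abs_one_sub_mul_le {m θ s : ℝ} (hmθ : m ≤ θ) (hθ : θ ≤ m ∨ θ + m ≤ 1) (hs0 : 0 ≤ s)
    (hs2 : s ≤ 2) : |1 - θ * s| ≤ |1 - m * s| := by
  rcases hθ with hθm | hsum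
  · rw [le_antisymm hθm hmθ]
  · have hlower : m * s ≤ θ * s := by gcongr
    have hupper : (θ + m) * s ≤ 1 * 2 := by nlinarith
    refine (abs_le.2 ⟨?_, ?_⟩).trans (le_abs_self _) <;> linarith

/-- Unless `w` is constant, an average `θ` of its entries satisfies `θ + vmin w ≤ 1`; since
`α n t ≤ 2`, the value `1 - α θ n t` then stays above `-(1 - α n (vmin w) t)`. -/
theorem max_abs_one_sub_le_qC (hv : v ∈ stdSimplex ℝ (Fin n)) (hw : IsPositiveStochastic w)
    {μ L α : ℝ} (hμ : 0 ≤ μ) (hμL : μ ≤ L) (hα : 0 ≤ α) (hαL : α * n * L ≤ 2) :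
    max |1 - α * (v ⬝ᵥ w) * n * μ| |1 - α * (v ⬝ᵥ w) * n * L| ≤ qC μ L α w := by
  have hmax : v ⬝ᵥ w ≤ vmax w := dotProduct_le_of_forall_le hv (le_vmax w)
  have hθ : v ⬝ᵥ w ≤ vmin w ∨ v ⬝ᵥ w + vmin w ≤ 1 :=
    (vmax_le_vmin_or_vmax_add_vmin_le_one hw).imp hmax.trans (add_le_add_left hmax _).trans
  have hfactor {t : ℝ} (ht0 : 0 ≤ t) (htL : t ≤ L) :
      |1 - α * (v ⬝ᵥ w) * n * t| ≤ |1 - α * n * vmin w * t| := by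
    have ht2 : α * n * t ≤ 2 := hαL.trans' (by gcongr)
    convert abs_one_sub_mul_le (vmin_le_dotProduct hv) hθ (by positivity) ht2 using 3 <;> ring
  exact max_le_max (hfactor hμ hμL) (hfactor (hμ.trans hμL) le_rfl)

theorem SmoothCosts.norm_gradient_step_avgFun_sub_le
    {f : Fin n → EuclideanSpace ℝ (Fin p) → ℝ} {μ L α : ℝ} (hf : SmoothCosts f L)
    (hconv : StronglyConvexAvg f μ) (hv : v ∈ stdSimplex ℝ (Fin n)) (hw : IsPositiveStochastic w)
    (hL : 0 ≤ L) (hμ : 0 ≤ μ) (hα : 0 ≤ α) (hαL : α * n * L ≤ 2)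
    (x u : EuclideanSpace ℝ (Fin p)) :
    ‖(x - (α * (v ⬝ᵥ w) * n) • gradient (avgFun f) x) -
        (u - (α * (v ⬝ᵥ w) * n) • gradient (avgFun f) u)‖ ≤ qC μ L α w * ‖x - u‖ := by
  have hupper := hf.inner_gradient_avgFun_sub_le hL
  rcases eq_or_ne x u with rfl | hxu
  · simp
  have hμL : μ ≤ L := by
    have hpos : 0 < ‖x - u‖ := norm_sub_pos_iff.2 hxu
    exact le_of_mul_le_mul_right ((hconv x u).trans (hupper x u)) (by positivity)
  have hstep : 0 ≤ α * (v ⬝ᵥ w) * n := by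
    have := hw.vmin_pos.le.trans (vmin_le_dotProduct hv)
    positivity
  have hgrad (z : EuclideanSpace ℝ (Fin p)) :
      HasGradientAt (avgFun f) (gradient (avgFun f) z) z :=
    (hf.hasGradientAt_avgFun z).differentiableAt.hasGradientAt
  refine (norm_sub_smul_gradient_sub_le hgrad hconv hupper hstep x u).trans ?_
  gcongr
  exact max_abs_one_sub_le_qC hv hw hμ hμL hα hαL

end StepSize

/-! ### One step of the error recursion -/

section Tracker

variable {n p : ℕ} {v w : Fin n → ℝ} {y g : Fin n → EuclideanSpace ℝ (Fin p)}

theorem rC_nonneg : 0 ≤ rC w := by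
  unfold rC
  positivity

theorem trackErr_add_le (hw : IsPositiveStochastic w) :
    trackErr (y + g) w ≤ trackErr y w + trackErr g w := by
  simp only [trackErr_eq_consErr hw.pos, Pi.add_apply, smul_add]
  exact consErr_add_le hw.nonneg

theorem trackErr_le_rC_mul (hw : IsPositiveStochastic w) :
    trackErr g w ≤ rC w * wnorm 1 g := by
  have hmin := hw.vmin_pos
  have hscale : wnorm w (fun i => (w i)⁻¹ • g i) ≤ 1 / √(vmin w) * wnorm 1 g := by
    refine wnorm_le_mul_wnorm (by positivity) fun i => ?_
    have hi := hw.pos i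
    calc w i * ‖(w i)⁻¹ • g i‖ ^ 2 = 1 / w i * ‖g i‖ ^ 2 := by
          rw [norm_smul, norm_inv, Real.norm_of_nonneg hi.le]
          field_simp
      _ ≤ 1 / vmin w * ‖g i‖ ^ 2 := by
          gcongr
          exact vmin_le w i
      _ = (1 / √(vmin w)) ^ 2 * ((1 : Fin n → ℝ) i * ‖g i‖ ^ 2) := by
          rw [div_pow, Real.sq_sqrt hmin.le, one_pow, Pi.one_apply, one_mul]
  calc trackErr g w = consErr (fun i => (w i)⁻¹ • g i) w := trackErr_eq_consErr hw.pos
    _ ≤ wnorm w (fun i => (w i)⁻¹ • g i) := consErr_le_wnorm hw.mem_stdSimplex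
    _ ≤ 1 / √(vmin w) * wnorm 1 g := hscale
    _ ≤ rC w * wnorm 1 g :=
        mul_le_mul_of_nonneg_right (le_add_of_nonneg_left (Real.sqrt_nonneg _)) wnorm_nonneg

theorem wnorm_sub_smul_sum_le_trackErr (hv : v ≤ 1) (hw : IsPositiveStochastic w) :
    wnorm v (fun i => y i - w i • ∑ l, y l) ≤ trackErr y w := by
  have hscale (i : Fin n) : y i - w i • ∑ l, y l = w i • ((w i)⁻¹ • y i - ∑ l, y l) := by
    rw [smul_sub, smul_inv_smul₀ (hw.pos i).ne']
  simp only [hscale]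
  exact wnorm_smul_le_wnorm hv hw.nonneg (le_one_of_mem_stdSimplex hw.mem_stdSimplex)

theorem norm_wavg_sub_smul_sum_le_trackErr (hv : v ∈ stdSimplex ℝ (Fin n))
    (hw : IsPositiveStochastic w) : ‖wavg v y - (v ⬝ᵥ w) • ∑ l, y l‖ ≤ trackErr y w := by
  have hsub : wavg v y - (v ⬝ᵥ w) • ∑ l, y l = wavg v (fun i => y i - w i • ∑ l, y l) := by
    simp only [wavg, dotProduct, smul_sub, smul_smul, Finset.sum_sub_distrib, Finset.sum_smul]
  rw [hsub]
  exact (norm_wavg_le_wnorm hv).trans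
    (wnorm_sub_smul_sum_le_trackErr (le_one_of_mem_stdSimplex hv) hw)

theorem wnorm_le_trackErr_add_norm_sum (hv0 : 0 ≤ v) (hv : v ≤ 1) (hw : IsPositiveStochastic w) :
    wnorm v y ≤ trackErr y w + ‖∑ l, y l‖ := by
  have hsplit : y = (fun i => y i - w i • ∑ l, y l) + fun i => w i • ∑ l, y l := by
    ext1 i
    exact (sub_add_cancel _ _).symm
  calc wnorm v y
      ≤ wnorm v (fun i => y i - w i • ∑ l, y l) + wnorm v (fun i => w i • ∑ l, y l) :=
        (congrArg (wnorm v) hsplit).trans_le (wnorm_add_le hv0)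
    _ ≤ trackErr y w + wnorm w (fun _ => ∑ l, y l) :=
        add_le_add (wnorm_sub_smul_sum_le_trackErr hv hw)
          (wnorm_smul_le_wnorm hv hw.nonneg (le_one_of_mem_stdSimplex hw.mem_stdSimplex))
    _ = trackErr y w + ‖∑ l, y l‖ := by rw [wnorm_const hw.sum_eq_one]

end Tracker

/-- The relations between the components of a state that the iteration preserves: `s` is the
extrapolation of `x`, and the sum of the trackers `y` is the sum of the local gradients at `s`. -/
structure IsConsistent {n p : ℕ} (f : Fin n → EuclideanSpace ℝ (Fin p) → ℝ) (γ : ℝ)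
    (σ : State n p) : Prop where
  s_eq : σ.s = σ.x + γ • (σ.x - σ.xPrev)
  sum_y : ∑ i, σ.y i = ∑ i, gradient (f i) (σ.s i)

section Step

variable {n p : ℕ} {f : Fin n → EuclideanSpace ℝ (Fin p) → ℝ} {A B : Matrix (Fin n) (Fin n) ℝ}
  {φ φ' π π' : Fin n → ℝ} {μ L α β γ c τ : ℝ} {σ : State n p} {xStar : EuclideanSpace ℝ (Fin p)}

theorem nextX_eq : nextX A α β σ = mix A σ.s - α • σ.y + β • (σ.x - σ.xPrev) := rfl

theorem nextY_eq : nextY f A B α β γ σ = mix B σ.y +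
    fun i => gradient (f i) (nextS A α β γ σ i) - gradient (f i) (σ.s i) :=
  funext fun _ => add_sub_assoc _ _ _

namespace IsConsistent

theorem wavg_nextX (hσ : IsConsistent f γ σ) (hφA : φ' ᵥ* A = φ) :
    wavg φ' (nextX A α β σ) = wavg φ σ.x + γ • wavg φ (σ.x - σ.xPrev) - α • wavg φ' σ.y +
      β • wavg φ' (σ.x - σ.xPrev) := by
  rw [nextX_eq, wavg_add, wavg_sub, wavg_smul, wavg_smul, wavg_mix, hφA, hσ.s_eq, wavg_add,
    wavg_smul]

theorem nextX_sub (hσ : IsConsistent f γ σ) (m : EuclideanSpace ℝ (Fin p)) :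
    nextX A α β σ - σ.x = (fun i => mix A σ.x i - m) - (fun i => σ.x i - m) +
      γ • mix A (σ.x - σ.xPrev) - α • σ.y + β • (σ.x - σ.xPrev) := by
  rw [nextX_eq, hσ.s_eq, mix_add, mix_smul]
  ext1 i
  simp only [Pi.add_apply, Pi.sub_apply, Pi.smul_apply]
  abel

theorem nextS_sub (hσ : IsConsistent f γ σ) :
    nextS A α β γ σ - σ.s = (1 + γ) • (nextX A α β σ - σ.x) - γ • (σ.x - σ.xPrev) := by
  rw [hσ.s_eq]
  ext1 i
  simp only [nextS, Pi.add_apply, Pi.sub_apply, Pi.smul_apply]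
  module

theorem norm_sum_y_sub_le (hσ : IsConsistent f γ σ) (hf : SmoothCosts f L) (hL : 0 ≤ L)
    (hγ : 0 ≤ γ) (hφ : IsPositiveStochastic φ) (u : EuclideanSpace ℝ (Fin p)) :
    ‖∑ i, σ.y i - ∑ i, gradient (f i) u‖ ≤ L * √(n : ℝ) *
      (varphiC φ * (‖wavg φ σ.x - u‖ + consErr σ.x φ) + γ * wnorm 1 (σ.x - σ.xPrev)) := by
  have hs : wnorm 1 (σ.s - fun _ => u) ≤
      wnorm 1 (fun i => σ.x i - u) + γ * wnorm 1 (σ.x - σ.xPrev) := by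
    have hsplit : (σ.s - fun _ => u) = (fun i => σ.x i - u) + γ • (σ.x - σ.xPrev) := by
      rw [hσ.s_eq, add_sub_right_comm]
      rfl
    rw [hsplit]
    refine (wnorm_add_le zero_le_one).trans_eq ?_
    rw [wnorm_smul, abs_of_nonneg hγ]
  rw [hσ.sum_y]
  refine (hf.norm_sum_gradient_sub_le hL σ.s fun _ => u).trans ?_
  refine mul_le_mul_of_nonneg_left (hs.trans ?_) (by positivity)
  gcongr
  refine hφ.wnorm_one_le_varphiC_mul.trans ?_
  exact mul_le_mul_of_nonneg_left (wnorm_sub_const_le hφ.mem_stdSimplex u) (Real.sqrt_nonneg _)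

theorem norm_sum_y_le (hσ : IsConsistent f γ σ) (hf : SmoothCosts f L) (hL : 0 ≤ L)
    (hγ : 0 ≤ γ) (hφ : IsPositiveStochastic φ) (hx : gradient (avgFun f) xStar = 0) :
    ‖∑ i, σ.y i‖ ≤ L * √(n : ℝ) * (varphiC φ * (‖wavg φ σ.x - xStar‖ + consErr σ.x φ) +
      γ * wnorm 1 (σ.x - σ.xPrev)) := by
  simpa only [hf.sum_gradient, hx, smul_zero, sub_zero] using
    hσ.norm_sum_y_sub_le hf hL hγ hφ xStar

theorem trackErr_nextY_le (hσ : IsConsistent f γ σ) (hf : SmoothCosts f L) (hL : 0 ≤ L)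
    (hγ : 0 ≤ γ) (hπ' : IsPositiveStochastic π')
    (hB : trackErr (mix B σ.y) π' ≤ τ * trackErr σ.y π) :
    trackErr (nextY f A B α β γ σ) π' ≤ τ * trackErr σ.y π +
      L * rC π' * ((1 + γ) * wnorm 1 (nextX A α β σ - σ.x) + γ * wnorm 1 (σ.x - σ.xPrev)) := by
  have hmove : wnorm 1 (nextS A α β γ σ - σ.s) ≤
      (1 + γ) * wnorm 1 (nextX A α β σ - σ.x) + γ * wnorm 1 (σ.x - σ.xPrev) := by
    rw [hσ.nextS_sub]
    refine (wnorm_sub_le zero_le_one).trans_eq ?_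
    rw [wnorm_smul, wnorm_smul, abs_of_nonneg hγ, abs_of_nonneg (by positivity)]
  rw [nextY_eq]
  refine (trackErr_add_le hπ').trans (add_le_add hB ?_)
  refine (trackErr_le_rC_mul hπ').trans ?_
  rw [mul_comm L, mul_assoc]
  refine mul_le_mul_of_nonneg_left ?_ rC_nonneg
  exact (hf.wnorm_one_gradient_sub_le hL _ _).trans (mul_le_mul_of_nonneg_left hmove hL)

theorem consErr_nextX_le (hσ : IsConsistent f γ σ) (hf : SmoothCosts f L) (hL : 0 ≤ L)
    (hα : 0 ≤ α) (hβ : 0 ≤ β) (hγ : 0 ≤ γ) (hx : gradient (avgFun f) xStar = 0)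
    (hφ : IsPositiveStochastic φ) (hφ' : φ' ∈ stdSimplex ℝ (Fin n)) (hπ : IsPositiveStochastic π)
    (hc : 0 ≤ c) (hA : consErr (mix A σ.s) φ' ≤ c * consErr σ.s φ) :
    consErr (nextX A α β σ) φ' ≤ α * L * √(n : ℝ) * varphiC φ * ‖wavg φ σ.x - xStar‖ +
      (c + α * L * √(n : ℝ) * varphiC φ) * consErr σ.x φ + α * trackErr σ.y π +
      (β + γ * (c + α * L * √(n : ℝ))) * wnorm 1 (σ.x - σ.xPrev) := by
  set Δ := σ.x - σ.xPrev with hΔ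
  have hsplit : consErr (nextX A α β σ) φ' ≤
      consErr (mix A σ.s) φ' + α * consErr σ.y φ' + β * consErr Δ φ' := by
    rw [nextX_eq]
    refine (consErr_add_le hφ'.1).trans (add_le_add ((consErr_sub_le hφ'.1).trans_eq ?_)
      (le_of_eq ?_)) <;> simp only [consErr_smul, abs_of_nonneg hα, abs_of_nonneg hβ, hΔ]
  have hs : consErr σ.s φ ≤ consErr σ.x φ + γ * wnorm 1 Δ := by
    rw [hσ.s_eq]
    refine (consErr_add_le hφ.nonneg).trans ?_
    rw [consErr_smul, abs_of_nonneg hγ]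
    gcongr
    exact consErr_le_wnorm_one hφ.mem_stdSimplex
  have hy : consErr σ.y φ' ≤ trackErr σ.y π + ‖∑ i, σ.y i‖ := (consErr_le_wnorm hφ').trans
    (wnorm_le_trackErr_add_norm_sum hφ'.1 (le_one_of_mem_stdSimplex hφ') hπ)
  have hY := hσ.norm_sum_y_le hf hL hγ hφ hx
  linear_combination hsplit + hA + c * hs + α * (hy + hY) +
    β * consErr_le_wnorm_one (z := Δ) hφ'

theorem wnorm_nextX_sub_le (hσ : IsConsistent f γ σ) (hf : SmoothCosts f L) (hL : 0 ≤ L)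
    (hα : 0 ≤ α) (hβ : 0 ≤ β) (hγ : 0 ≤ γ) (hx : gradient (avgFun f) xStar = 0)
    (hφ : IsPositiveStochastic φ) (hφ' : IsPositiveStochastic φ') (hπ : IsPositiveStochastic π)
    (hrow : A ∈ Matrix.rowStochastic ℝ (Fin n)) (hφA : φ' ᵥ* A = φ)
    (hA : consErr (mix A σ.x) φ' ≤ c * consErr σ.x φ) :
    wnorm 1 (nextX A α β σ - σ.x) ≤ α * L * √(n : ℝ) * varphiC φ * ‖wavg φ σ.x - xStar‖ +
      (c * varphiC φ' + varphiC φ + α * L * √(n : ℝ) * varphiC φ) * consErr σ.x φ +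
      α * trackErr σ.y π + (β + γ * √(n : ℝ) * (1 + α * L)) * wnorm 1 (σ.x - σ.xPrev) := by
  set Δ := σ.x - σ.xPrev with hΔ
  set m := wavg φ σ.x with hm
  have hsplit : wnorm 1 (nextX A α β σ - σ.x) ≤ wnorm 1 (fun i => mix A σ.x i - m) +
      wnorm 1 (fun i => σ.x i - m) + γ * wnorm 1 (mix A Δ) + α * wnorm 1 σ.y + β * wnorm 1 Δ := by
    rw [hσ.nextX_sub m, ← hΔ]
    refine (wnorm_add_le zero_le_one).trans (add_le_add ?_ ?_)
    · refine (wnorm_sub_le zero_le_one).trans (add_le_add ?_ ?_)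
      · refine (wnorm_add_le zero_le_one).trans (add_le_add (wnorm_sub_le zero_le_one) ?_)
        rw [wnorm_smul, abs_of_nonneg hγ]
      · rw [wnorm_smul, abs_of_nonneg hα]
    · rw [wnorm_smul, abs_of_nonneg hβ]
  have hmix : wnorm 1 (fun i => mix A σ.x i - m) ≤ varphiC φ' * (c * consErr σ.x φ) := by
    rw [hm, ← hφA, ← wavg_mix, hφA]
    exact hφ'.wnorm_one_le_varphiC_mul.trans
      (mul_le_mul_of_nonneg_left hA (Real.sqrt_nonneg _))
  have hcons : wnorm 1 (fun i => σ.x i - m) ≤ varphiC φ * consErr σ.x φ :=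
    hφ.wnorm_one_le_varphiC_mul
  have hmixΔ : wnorm 1 (mix A Δ) ≤ √(n : ℝ) * wnorm 1 Δ := wnorm_one_mix_le hrow
  have hy : wnorm 1 σ.y ≤ trackErr σ.y π + ‖∑ i, σ.y i‖ :=
    wnorm_le_trackErr_add_norm_sum zero_le_one le_rfl hπ
  have hY := hσ.norm_sum_y_le hf hL hγ hφ hx
  linear_combination hsplit + hmix + hcons + γ * hmixΔ + α * (hy + hY)

theorem wavg_nextX_sub (hσ : IsConsistent f γ σ) (hf : SmoothCosts f L)
    (hx : gradient (avgFun f) xStar = 0) (hφA : φ' ᵥ* A = φ) (θ : ℝ) :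
    wavg φ' (nextX A α β σ) - xStar =
      ((wavg φ σ.x - (α * θ * n) • gradient (avgFun f) (wavg φ σ.x)) -
          (xStar - (α * θ * n) • gradient (avgFun f) xStar)) -
        (α * θ) • (∑ i, σ.y i - ∑ i, gradient (f i) (wavg φ σ.x)) -
        α • (wavg φ' σ.y - θ • ∑ i, σ.y i) + γ • wavg φ (σ.x - σ.xPrev) +
        β • wavg φ' (σ.x - σ.xPrev) := by
  rw [hσ.wavg_nextX hφA, hf.sum_gradient, hx]
  module

theorem norm_wavg_nextX_sub_le (hσ : IsConsistent f γ σ) (hf : SmoothCosts f L)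
    (hconv : StronglyConvexAvg f μ) (hL : 0 ≤ L) (hμ : 0 ≤ μ)
    (hα : 0 ≤ α) (hαL : α * n * L ≤ 2) (hβ : 0 ≤ β) (hγ : 0 ≤ γ)
    (hx : gradient (avgFun f) xStar = 0) (hφ : IsPositiveStochastic φ)
    (hφ' : φ' ∈ stdSimplex ℝ (Fin n)) (hφA : φ' ᵥ* A = φ) (hπ : IsPositiveStochastic π) :
    ‖wavg φ' (nextX A α β σ) - xStar‖ ≤ qC μ L α π * ‖wavg φ σ.x - xStar‖ +
      α * L * √(n : ℝ) * varphiC φ * consErr σ.x φ + α * trackErr σ.y π +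
      (β + γ * (1 + α * L * √(n : ℝ))) * wnorm 1 (σ.x - σ.xPrev) := by
  set Δ := σ.x - σ.xPrev
  set m := wavg φ σ.x with hm
  set θ := φ' ⬝ᵥ π
  have hθ0 : 0 ≤ θ := hπ.vmin_pos.le.trans (vmin_le_dotProduct hφ')
  have hθ1 : θ ≤ 1 :=
    dotProduct_le_of_forall_le hφ' (le_one_of_mem_stdSimplex hπ.mem_stdSimplex)
  have hsplit : ‖wavg φ' (nextX A α β σ) - xStar‖ ≤
      ‖(m - (α * θ * n) • gradient (avgFun f) m) -
          (xStar - (α * θ * n) • gradient (avgFun f) xStar)‖ +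
        α * θ * ‖∑ i, σ.y i - ∑ i, gradient (f i) m‖ + α * ‖wavg φ' σ.y - θ • ∑ i, σ.y i‖ +
        γ * ‖wavg φ Δ‖ + β * ‖wavg φ' Δ‖ := by
    rw [hσ.wavg_nextX_sub hf hx hφA θ]
    refine norm_add_le_of_le (norm_add_le_of_le (norm_sub_le_of_le (norm_sub_le_of_le le_rfl ?_)
      ?_) ?_) ?_ <;> exact (norm_smul_of_nonneg (by positivity) _).le
  have hgrad := hf.norm_gradient_step_avgFun_sub_le hconv hφ' hπ hL hμ hα hαL m xStar
  have hsum := hσ.norm_sum_y_sub_le hf hL hγ hφ m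
  rw [← hm, sub_self, norm_zero, zero_add] at hsum
  have hbias : α * θ * ‖∑ i, σ.y i - ∑ i, gradient (f i) m‖ ≤
      α * (L * √(n : ℝ) * (varphiC φ * consErr σ.x φ + γ * wnorm 1 Δ)) :=
    mul_le_mul (mul_le_of_le_one_right hα hθ1) hsum (norm_nonneg _) hα
  have htrack : ‖wavg φ' σ.y - θ • ∑ i, σ.y i‖ ≤ trackErr σ.y π :=
    norm_wavg_sub_smul_sum_le_trackErr hφ' hπ
  have hΔφ : ‖wavg φ Δ‖ ≤ wnorm 1 Δ := norm_wavg_le_wnorm_one hφ.mem_stdSimplex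
  have hΔφ' : ‖wavg φ' Δ‖ ≤ wnorm 1 Δ := norm_wavg_le_wnorm_one hφ'
  linear_combination hsplit + hgrad + hbias + α * htrack + γ * hΔφ + β * hΔφ'

end IsConsistent

end Step

/-! ### The iterates -/

section Iterates

variable {n p : ℕ}

theorem IsConsistent.errVec_step_le {f : Fin n → EuclideanSpace ℝ (Fin p) → ℝ} {μ L α β γ c τ : ℝ}
    {A B : Matrix (Fin n) (Fin n) ℝ} {φ φ' π π' : Fin n → ℝ} {σ : State n p}
    {xStar : EuclideanSpace ℝ (Fin p)} (hσ : IsConsistent f γ σ) (hf : SmoothCosts f L)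
    (hconv : StronglyConvexAvg f μ) (hL : 0 ≤ L) (hμ : 0 ≤ μ)
    (hα : 0 ≤ α) (hαL : α * n * L ≤ 2) (hβ : 0 ≤ β) (hγ : 0 ≤ γ)
    (hx : gradient (avgFun f) xStar = 0) (hφ : IsPositiveStochastic φ)
    (hφ' : IsPositiveStochastic φ') (hφA : φ' ᵥ* A = φ) (hπ : IsPositiveStochastic π)
    (hπ' : IsPositiveStochastic π') (hrow : A ∈ Matrix.rowStochastic ℝ (Fin n)) (hc : 0 ≤ c)
    (hA : ∀ z : Fin n → EuclideanSpace ℝ (Fin p), consErr (mix A z) φ' ≤ c * consErr z φ)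
    (hB : trackErr (mix B σ.y) π' ≤ τ * trackErr σ.y π) :
    errVec ⟨σ.x, nextX A α β σ, nextS A α β γ σ, nextY f A B α β γ σ⟩ φ' π' xStar ≤
      matM n L α β γ (qC μ L α π) c τ (rC π') (varphiC φ) (varphiC φ') *ᵥ
        errVec σ φ π xStar := by
  have haverage := hσ.norm_wavg_nextX_sub_le hf hconv hL hμ hα hαL hβ hγ hx hφ
    hφ'.mem_stdSimplex hφA hπ
  have hconsensus := hσ.consErr_nextX_le hf hL hα hβ hγ hx hφ hφ'.mem_stdSimplex hπ hc (hA σ.s)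
  have hmove := hσ.wnorm_nextX_sub_le hf hL hα hβ hγ hx hφ hφ' hπ hrow hφA (hA σ.x)
  have htrack := hσ.trackErr_nextY_le (A := A) (α := α) (β := β) hf hL hγ hπ' hB
  have hfactor : 0 ≤ L * rC π' * (1 + γ) := mul_nonneg (mul_nonneg hL rC_nonneg) (by positivity)
  intro i
  fin_cases i <;>
    simp only [errVec, matM, Matrix.mulVec, dotProduct, Fin.sum_univ_four, Matrix.of_apply,
      Matrix.cons_val, Fin.zero_eta, Fin.mk_one, Fin.reduceFinMk]
  · exact haverage
  · exact hconsensus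
  · exact htrack.trans (by linear_combination (L * rC π' * (1 + γ)) * hmove)
  · exact hmove

theorem sum_mix_of_mem_colStochastic {C : Matrix (Fin n) (Fin n) ℝ}
    {z : Fin n → EuclideanSpace ℝ (Fin p)} (hC : C ∈ Matrix.colStochastic ℝ (Fin n)) :
    ∑ i, mix C z i = ∑ i, z i := by
  simpa only [wavg, Matrix.one_vecMul_of_mem_colStochastic hC, Pi.one_apply, one_smul] using
    wavg_mix (w := 1) (C := C) z

theorem sum_iter_y (f : Fin n → EuclideanSpace ℝ (Fin p) → ℝ)
    (A : ℕ → Matrix (Fin n) (Fin n) ℝ) {B : ℕ → Matrix (Fin n) (Fin n) ℝ}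
    (hB : ∀ k, B k ∈ Matrix.colStochastic ℝ (Fin n)) (α β γ : ℝ)
    (xInit x0 s0 : Fin n → EuclideanSpace ℝ (Fin p)) (k : ℕ) :
    ∑ i, (iter f A B α β γ xInit x0 s0 k).y i =
      ∑ i, gradient (f i) ((iter f A B α β γ xInit x0 s0 k).s i) := by
  induction k with
  | zero => rfl
  | succ k ih =>
    simp only [iter, nextY_eq, Pi.add_apply, Finset.sum_add_distrib, Finset.sum_sub_distrib,
      sum_mix_of_mem_colStochastic (hB k), ih, add_sub_cancel]

theorem isConsistent_iter (f : Fin n → EuclideanSpace ℝ (Fin p) → ℝ)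
    (A : ℕ → Matrix (Fin n) (Fin n) ℝ) {B : ℕ → Matrix (Fin n) (Fin n) ℝ}
    (hB : ∀ k, B k ∈ Matrix.colStochastic ℝ (Fin n)) (α β : ℝ) {γ : ℝ}
    {xInit x0 s0 : Fin n → EuclideanSpace ℝ (Fin p)} {k : ℕ}
    (hk : 1 ≤ k ∨ ∀ i, s0 i = x0 i + γ • (x0 i - xInit i)) :
    IsConsistent f γ (iter f A B α β γ xInit x0 s0 k) where
  s_eq := by
    cases k with
    | zero => exact funext (hk.resolve_left (by simp))
    | succ k => rfl
  sum_y := sum_iter_y f A hB α β γ xInit x0 s0 k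

end Iterates

end ABPushPull

open ABPushPull in
theorem mainTheorem2_general {n p : ℕ}
    (G : ℕ → Digraph (Fin n)) (A B : ℕ → Matrix (Fin n) (Fin n) ℝ) (a b : ℝ)
    (hnet : IsNetwork G A B a b)
    (f : Fin n → EuclideanSpace ℝ (Fin p) → ℝ) (L μ : ℝ) (hL : 0 < L) (hμ : 0 ≤ μ)
    (hf : SmoothCosts f L) (hconv : StronglyConvexAvg f μ)
    (xStar : EuclideanSpace ℝ (Fin p))
    (hxStar : IsMinOn (avgFun f) Set.univ xStar)
    (φ : ℕ → Fin n → ℝ) (hφ : IsAbsProbSeq A φ)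
    (α β γ : ℝ) (hα : α ∈ Set.Icc 0 (2 / (n * L))) (hβ : 0 ≤ β) (hγ : 0 ≤ γ)
    (xInit x0 s0 : Fin n → EuclideanSpace ℝ (Fin p))
    (k : ℕ) (hk : 1 ≤ k ∨ ∀ i, s0 i = x0 i + γ • (x0 i - xInit i)) :
    errVec (iter f A B α β γ xInit x0 s0 (k + 1))
        (φ (k + 1)) (piSeq B (k + 1)) xStar ≤
      stepMatrix G φ (piSeq B) a b L μ α β γ k *ᵥ
        errVec (iter f A B α β γ xInit x0 s0 k)
          (φ k) (piSeq B k) xStar := by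
  have hφpos := hφ.isPositiveStochastic hnet.strong hnet.row hnet.alignA
  have hn : 0 < n := Fin.pos_iff_nonempty.2 (hφpos 0).nonempty
  have hπpos := isPositiveStochastic_piSeq hn hnet.col fun k => (hnet.alignB k).diag_pos
  have hcontractA := fun z : Fin n → EuclideanSpace ℝ (Fin p) =>
    (hnet.alignA k).consErr_mix_le (z := z) (hnet.strong k) (hnet.row k)
      (hφpos (k + 1)).mem_stdSimplex (hφ.2 k) (hφpos k).mem_stdSimplex hnet.a_pos.le (hnet.a_le k)
  have hcontractB := (hnet.alignB k).trackErr_mix_le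
    (y := (iter f A B α β γ xInit x0 s0 k).y) (hnet.strong k) (hnet.col k) (hπpos k)
    (hπpos (k + 1)) hnet.b_pos.le (hnet.b_le k)
  have hαL : α * n * L ≤ 2 := by
    have hnL : 0 < n * L := by positivity
    rw [mul_assoc]
    exact (le_div_iff₀ hnL).1 hα.2
  have hgrad := gradient_eq_zero_of_isLocalMin (hxStar.isLocalMin Filter.univ_mem)
  exact (isConsistent_iter f A hnet.col α β hk).errVec_step_le hf hconv hL.le hμ hα.1
    hαL hβ hγ hgrad (hφpos k) (hφpos (k + 1)) (hφ.2 k) (hπpos k) (hπpos (k + 1)) (hnet.row k)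
    (Real.sqrt_nonneg _) hcontractA hcontractB

theorem mainTheorem2 {n p : ℕ} (hn : 1 ≤ n)
    (G : ℕ → Digraph (Fin n)) (A B : ℕ → Matrix (Fin n) (Fin n) ℝ) (a b : ℝ)
    (hnet : ABPushPull.IsNetwork G A B a b)
    (f : Fin n → EuclideanSpace ℝ (Fin p) → ℝ) (L μ : ℝ) (hL : 0 < L) (hμ : 0 < μ)
    (hf : ABPushPull.SmoothCosts f L) (hconv : ABPushPull.StronglyConvexAvg f μ)
    (xStar : EuclideanSpace ℝ (Fin p))
    (hxStar : IsMinOn (ABPushPull.avgFun f) Set.univ xStar)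
    (φ : ℕ → Fin n → ℝ) (hφ : ABPushPull.IsAbsProbSeq A φ)
    (α β γ : ℝ) (hα : α ∈ Set.Ioo 0 (2 / (n * L))) (hβ : 0 ≤ β) (hγ : 0 ≤ γ)
    (xInit x0 s0 : Fin n → EuclideanSpace ℝ (Fin p))
    (k : ℕ) (hk : 1 ≤ k ∨ ∀ i, s0 i = x0 i + γ • (x0 i - xInit i)) :
    ABPushPull.errVec (ABPushPull.iter f A B α β γ xInit x0 s0 (k + 1))
        (φ (k + 1)) (ABPushPull.piSeq B (k + 1)) xStar ≤
      ABPushPull.stepMatrix G φ (ABPushPull.piSeq B) a b L μ α β γ k *ᵥ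
        ABPushPull.errVec (ABPushPull.iter f A B α β γ xInit x0 s0 k)
          (φ k) (ABPushPull.piSeq B k) xStar :=
  mainTheorem2_general G A B a b hnet f L μ hL hμ.le hf hconv xStar hxStar φ hφ α β γ
    (Set.Ioo_subset_Icc_self hα) hβ hγ xInit x0 s0 k hk
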